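/- Let $n\ge 1$, let $\mathbb{S}^n\subset\mathbb{R}^{n+1}$ be the unit sphere with its Riemannian volume measure $dq$ and Riemannian distance $d_R(p,q)=\arccos\langle p,q\rangle$, and let $V_m=\mathrm{vol}(\mathbb{S}^m)$. Write $B(p_0,a)=\{q\in\mathbb{S}^n: d_R(p_0,q)<a\}$ and let $|B_a|$ be its volume. Let $B_x(\alpha,\beta)=\int_0^x t^{\alpha-1}(1-t)^{\beta-1}\,dt$ be the incomplete beta function, $(x)_k=x(x+1)\cdots(x+k-1)$, $(x)_0=1$, the Pochhammer symbol, and for $a\in(0,\pi)$ put $$K(\mathbb{S}^n,a)=\frac{2}{nV_n}\sum_{k=0}^{\infty}\frac{(n)_k}{\left(\frac n2+1\right)_k(k+1)}\,\frac{B_{\sin^2\frac a2}\left(\frac n2+k+1,\frac n2\right)}{B_{\sin^2\frac a2}\left(\frac n2,\frac n2\right)}.$$ Let $G$ be the Green function of $\mathbb{S}^n$, that is, the unique continuous real function on the pairs of distinct points of $\mathbb{S}^n$ such that, for all $p$, $G(p,\cdot)$ is integrable, $\Delta_qG(p,\cdot)=\delta_p-V_n^{-1}$ in the sense of distributions (where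 $\Delta=-\mathrm{div}\,\nabla$), $G(p,q)=G(q,p)$ for all $q\neq p$, and $\int_{\mathbb{S}^n}G(p,q)\,dq=0$. Let $p_0,p\in\mathbb{S}^n$ and $a\in(0,\pi)$. Then $$|B_a|=2^{n-1}V_{n-1}B_{\sin^2\frac a2}\left(\tfrac n2,\tfrac n2\right),$$ and moreover: (i) if $p\notin B(p_0,a)$, then $$\frac1{|B_a|}\int_{B(p_0,a)}G(p,q)\,dq=G(p,p_0)+K(\mathbb{S}^n,a);$$ (ii) if $p\in B(p_0,a)$, then $$\frac1{|B_a|}\int_{B(p_0,a)}G(p,q)\,dq=-\frac{B_{\cos^2\frac a2}\left(\frac n2,\frac n2\right)}{B_{\sin^2\frac a2}\left(\frac n2,\frac n2\right)}\Bigl(G(p,-p_0)+K(\mathbb{S}^n,\pi-a)\Bigr).$$ -/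

import Mathlib

open MeasureTheory
open scoped Manifold ContDiff

noncomputable section

/-- The ambient Euclidean space `ℝ^{n+1}`. -/
abbrev Ambient (n : ℕ) : Type := EuclideanSpace ℝ (Fin (n + 1))

/-- The unit sphere `S^n ⊆ ℝ^{n+1}`. -/
abbrev USphere (n : ℕ) : Type := Metric.sphere (0 : Ambient n) 1

/-- The Riemannian volume (surface measure) of `S^n`, normalised so that a set `s` has
measure `(n + 1)` times the Lebesgue measure of the cone `(0,1) • s`. -/
def sphereMeasure (n : ℕ) : Measure (USphere n) :=
  (volume : Measure (Ambient n)).toSphere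

/-- `V_n`, the total volume of `S^n`. -/
def sphereVol (n : ℕ) : ℝ := (sphereMeasure n).real Set.univ

/-- The Riemannian distance `arccos ⟨p, q⟩` of the unit sphere. -/
def sphereDist {n : ℕ} (p q : USphere n) : ℝ :=
  Real.arccos (inner ℝ (p : Ambient n) (q : Ambient n))

/-- The open geodesic ball with centre `p₀` and radius `a`. -/
def geodesicBall {n : ℕ} (p₀ : USphere n) (a : ℝ) : Set (USphere n) :=
  {q | sphereDist p₀ q < a}

/-- The volume of a geodesic ball. -/
def ballVol {n : ℕ} (p₀ : USphere n) (a : ℝ) : ℝ :=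
  (sphereMeasure n).real (geodesicBall p₀ a)

/-- The radial projection `x ↦ x / ‖x‖` of `ℝ^{n+1} ∖ {0}` onto `S^n`. -/
def radialProj {n : ℕ} (x : Ambient n) (hx : x ≠ 0) : USphere n :=
  ⟨‖x‖⁻¹ • x, by simp [norm_smul, hx]⟩

open Classical in
/-- The extension of a function on `S^n` to `ℝ^{n+1}` that is constant along rays
(with the irrelevant value `0` at the origin). -/
def rayExtension {n : ℕ} (φ : USphere n → ℝ) (x : Ambient n) : ℝ :=
  if hx : x ≠ 0 then φ (radialProj x hx) else 0

/-- The Laplace-Beltrami operator of the round sphere with the sign convention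
`Δ = - div ∇`: minus the Euclidean Laplacian, at points of the sphere, of the extension
that is constant along rays. -/
def laplaceBeltrami {n : ℕ} (φ : USphere n → ℝ) (q : USphere n) : ℝ :=
  - Laplacian.laplacian (rayExtension φ) (q : Ambient n)

/-- `G` is a Green function of `S^n`. Only the values `G p q` with `p ≠ q` matter: the values
on the diagonal are unconstrained. -/
structure IsGreenFunction (n : ℕ) (G : USphere n → USphere n → ℝ) : Prop where
  /-- `G` is continuous off the diagonal. -/
  continuousOn : ContinuousOn (fun x : USphere n × USphere n => G x.1 x.2) {x | x.1 ≠ x.2}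
  /-- `G(p, ·)` is integrable. -/
  integrable : ∀ p, Integrable (G p) (sphereMeasure n)
  /-- `Δ_q G(p, ·) = δ_p - 1 / vol(S^n)` in the sense of distributions. -/
  laplacian : ∀ (p : USphere n) (φ : USphere n → ℝ), ContMDiff (𝓡 n) 𝓘(ℝ, ℝ) ∞ φ →
    ∫ q, G p q * laplaceBeltrami φ q ∂(sphereMeasure n)
      = φ p - (sphereVol n)⁻¹ * ∫ q, φ q ∂(sphereMeasure n)
  symm : ∀ p q, G p q = G q p
  /-- `G(p, ·)` has mean zero. -/
  mean_zero : ∀ p, ∫ q, G p q ∂(sphereMeasure n) = 0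

/-- The Green function of `S^n`: the function with the properties `IsGreenFunction`, which
determine it off the diagonal. -/
def greenFunction (n : ℕ) : USphere n → USphere n → ℝ :=
  Classical.epsilon (IsGreenFunction n)

/-- The incomplete beta function `B_x(α, β)`. -/
def incBeta (x α β : ℝ) : ℝ :=
  ∫ t in (0 : ℝ)..x, t ^ (α - 1) * (1 - t) ^ (β - 1)

/-- The constant `K(S^n, a)`; the Pochhammer symbol `(x)_k` is `(ascPochhammer ℝ k).eval x`. -/
def greenConst (n : ℕ) (a : ℝ) : ℝ :=
  2 / (n * sphereVol n) * ∑' k : ℕ,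
    (ascPochhammer ℝ k).eval (n : ℝ)
        / ((ascPochhammer ℝ k).eval ((n : ℝ) / 2 + 1) * ((k : ℝ) + 1))
      * (incBeta (Real.sin (a / 2) ^ 2) ((n : ℝ) / 2 + k + 1) ((n : ℝ) / 2)
        / incBeta (Real.sin (a / 2) ^ 2) ((n : ℝ) / 2) ((n : ℝ) / 2))

end

/-! Everything reduces to one variable. On functions of x = (1 - ⟨v, q⟩)/2 the Laplace-Beltrami
operator is Lψ = -(x(1-x)ψ'' + (n/2)(1-2x)ψ'), and the surface measure becomes a constant times
(x(1-x))^(n/2-1) dx (`map_poleCoord`). Let h = (2/n) ₂F₁(n, 1; n/2+1; ·) and let F be its primitive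
vanishing at 0. The equation `greenDeriv_ode` says LF = -1, and by the symmetry x ↦ 1 - x also
L(F(1-x)) = -1 away from the pole x = 0. Normalised to mean zero, F(1-x)/V_n is the Green function.

The carrying object is the potential ψ of a cap {x < ε} (`capPotential`): it is F(1-x) outside the
cap and a constant minus κF(x) inside. When κ is the ratio of the volumes of the complement and of
the cap, the two pieces match to first order, so Lψ = (κ+1)·1_cap - 1 with no mass on the boundary
of the cap. Testing ΔG(p, ·) = δ_p - 1/V_n against ψ, and using that G has mean zero, gives
(κ+1)∫_cap G(p, ·) = ψ(p) - mean(ψ). For p outside the cap, ψ(p) = F(1-x(p)) is V_n G(p, p₀) plus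
the mean of F(1-x). The two means differ by the mean of F over the cap
(`intervalIntegral_capPotential`, resting on the conserved quantity `capInvariant`), and
`greenConst_eq` recognises V_n⁻¹ times this cap mean, expanded termwise, as the constant K. This is
(i), in `IsGreenFunction.setIntegral_poleCap`. For (ii), the complement of the ball is, up to a null
set, the ball of radius π - a about -p₀; it does not contain p, and the integral of G over the whole
sphere is zero.

Since ψ is only C¹ while G is tested against smooth functions, `ZonalIdentity.of_polynomial` extends
an identity from polynomials in x to functions whose second derivative is a bounded limit of
continuous functions. Applied to a smooth φ instead of G, with ε → 0, the same identity proves that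
the closed form is a Green function (`isGreenFunction_explicitGreen`); uniqueness off the diagonal
is `IsGreenFunction.eq_of_ne`. The symmetry of Δ behind all this comes from Euclidean integration by
parts with radial cutoffs (`green_identity_with_weights`). -/

/-! ### Euclidean Laplacian of products, compositions and zonal functions -/

section EuclideanLaplacian

open Laplacian InnerProductSpace Filter Topology

variable {E : Type*} [NormedAddCommGroup E] [InnerProductSpace ℝ E] [FiniteDimensional ℝ E]

/-- The Laplacian as the trace of the second derivative. -/
theorem laplacian_eq_sum_fderiv {ι : Type*} [Fintype ι] (b : OrthonormalBasis ι ℝ E) (f : E → ℝ)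
    (x : E) : Δ f x = ∑ i, fderiv ℝ (fderiv ℝ f) x (b i) (b i) := by
  rw [laplacian_eq_iteratedFDeriv_orthonormalBasis f b]
  simp [iteratedFDeriv_two_apply]

theorem laplacian_eq_sum_of_hasFDerivAt {ι : Type*} [Fintype ι] (b : OrthonormalBasis ι ℝ E)
    {f : E → ℝ} {f' : E → E →L[ℝ] ℝ} {f'' : E →L[ℝ] E →L[ℝ] ℝ} {x : E}
    (h : ∀ᶠ y in 𝓝 x, HasFDerivAt f (f' y) y) (h' : HasFDerivAt f' f'' x) :
    Δ f x = ∑ i, f'' (b i) (b i) := by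
  have e : fderiv ℝ f =ᶠ[𝓝 x] f' := h.mono fun y hy => hy.fderiv
  rw [laplacian_eq_sum_fderiv b, (h'.congr_of_eventuallyEq e).fderiv]

omit [FiniteDimensional ℝ E] in
theorem ContDiffAt.eventually_hasFDerivAt {f : E → ℝ} {x : E} (hf : ContDiffAt ℝ 2 f x) :
    ∀ᶠ y in 𝓝 x, HasFDerivAt f (fderiv ℝ f y) y :=
  (hf.eventually (by simp)).mono fun _ hy => (hy.differentiableAt (by simp)).hasFDerivAt

omit [FiniteDimensional ℝ E] in
theorem ContDiffAt.hasFDerivAt_fderiv {f : E → ℝ} {x : E} (hf : ContDiffAt ℝ 2 f x) :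
    HasFDerivAt (fderiv ℝ f) (fderiv ℝ (fderiv ℝ f) x) x :=
  ((hf.fderiv_right (m := 1) (by norm_num)).differentiableAt (by simp)).hasFDerivAt

theorem laplacian_mul {ι : Type*} [Fintype ι] (b : OrthonormalBasis ι ℝ E) {f g : E → ℝ} {x : E}
    (hf : ContDiffAt ℝ 2 f x) (hg : ContDiffAt ℝ 2 g x) :
    Δ (fun y => f y * g y) x
      = f x * Δ g x + 2 * ∑ i, fderiv ℝ f x (b i) * fderiv ℝ g x (b i) + g x * Δ f x := by
  have h1 : ∀ᶠ y in 𝓝 x, HasFDerivAt (fun y => f y * g y)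
      (f y • fderiv ℝ g y + g y • fderiv ℝ f y) y := by
    filter_upwards [hf.eventually_hasFDerivAt, hg.eventually_hasFDerivAt] with y h h'
    exact h.mul h'
  have h2 := ((hf.differentiableAt (by simp)).hasFDerivAt.smul hg.hasFDerivAt_fderiv).add
    ((hg.differentiableAt (by simp)).hasFDerivAt.smul hf.hasFDerivAt_fderiv)
  rw [laplacian_eq_sum_of_hasFDerivAt b h1 h2, laplacian_eq_sum_fderiv b f,
    laplacian_eq_sum_fderiv b g]
  simp only [Finset.mul_sum, ← Finset.sum_add_distrib]
  refine Finset.sum_congr rfl fun i _ => ?_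
  simp
  ring

theorem laplacian_comp {ι : Type*} [Fintype ι] (b : OrthonormalBasis ι ℝ E) {f : E → ℝ} {x : E}
    {ψ ψ' : ℝ → ℝ} {ψ'' : ℝ} (hf : ContDiffAt ℝ 2 f x)
    (hψ : ∀ᶠ s in 𝓝 (f x), HasDerivAt ψ (ψ' s) s) (hψ' : HasDerivAt ψ' ψ'' (f x)) :
    Δ (fun y => ψ (f y)) x = ψ'' * ∑ i, fderiv ℝ f x (b i) ^ 2 + ψ' (f x) * Δ f x := by
  have h1 : ∀ᶠ y in 𝓝 x, HasFDerivAt (fun y => ψ (f y)) (ψ' (f y) • fderiv ℝ f y) y := by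
    filter_upwards [hf.eventually_hasFDerivAt, hf.continuousAt.eventually hψ] with y h h'
    exact h'.comp_hasFDerivAt y h
  have h2 := (hψ'.comp_hasFDerivAt x (hf.differentiableAt (by simp)).hasFDerivAt).smul
    hf.hasFDerivAt_fderiv
  rw [laplacian_eq_sum_of_hasFDerivAt b h1 h2, laplacian_eq_sum_fderiv b f]
  simp only [Finset.mul_sum, ← Finset.sum_add_distrib]
  refine Finset.sum_congr rfl fun i _ => ?_
  simp
  ring

theorem laplacian_comp_smul {f : E → ℝ} {x : E} {c : ℝ} (hf : ContDiffAt ℝ 2 f (c • x)) :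
    Δ (fun y => f (c • y)) x = c ^ 2 * Δ f (c • x) := by
  let b := stdOrthonormalBasis ℝ E
  have hc : ∀ y : E, HasFDerivAt (fun y : E => c • y) (c • ContinuousLinearMap.id ℝ E) y :=
    fun y => (hasFDerivAt_id y).const_smul c
  have hcc : ContinuousAt (fun y : E => c • y) x := (hc x).continuousAt
  have h1 : ∀ᶠ y in 𝓝 x, HasFDerivAt (fun y => f (c • y)) (c • fderiv ℝ f (c • y)) y := by
    filter_upwards [hcc.eventually hf.eventually_hasFDerivAt] with y h
    convert! h.comp y (hc y) using 1
    ext z; simp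
  have h2 := (HasFDerivAt.comp x hf.hasFDerivAt_fderiv (hc x)).const_smul c
  rw [laplacian_eq_sum_of_hasFDerivAt b h1 h2, laplacian_eq_sum_fderiv b f, Finset.mul_sum]
  refine Finset.sum_congr rfl fun i _ => ?_
  simp
  ring

omit [FiniteDimensional ℝ E] in
theorem hasFDerivAt_norm_sq_inner (x : E) :
    HasFDerivAt (fun y : E => ‖y‖ ^ 2) ((2 : ℝ) • innerSL ℝ x) x := by
  refine (hasStrictFDerivAt_norm_sq x).hasFDerivAt.congr_fderiv ?_
  ext z; simp

theorem laplacian_norm_sq (x : E) :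
    Δ (fun y : E => ‖y‖ ^ 2) x = 2 * Module.finrank ℝ E := by
  let b := stdOrthonormalBasis ℝ E
  have h1 : ∀ᶠ y in 𝓝 x, HasFDerivAt (fun y : E => ‖y‖ ^ 2) (((2 : ℝ) • innerSL ℝ) y) y :=
    Eventually.of_forall fun y => hasFDerivAt_norm_sq_inner y
  rw [laplacian_eq_sum_of_hasFDerivAt b h1 ((2 : ℝ) • innerSL ℝ (E := E)).hasFDerivAt]
  have : ∀ i, ((2 : ℝ) • innerSL ℝ (E := E)) (b i) (b i) = 2 := fun i => by
    change (2 : ℝ) * inner ℝ (b i) (b i) = 2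
    simp
  simp only [this]
  simp [mul_comm]

omit [FiniteDimensional ℝ E] in
theorem sum_fderiv_norm_sq_sq {ι : Type*} [Fintype ι] (b : OrthonormalBasis ι ℝ E) (x : E) :
    ∑ i, fderiv ℝ (fun y : E => ‖y‖ ^ 2) x (b i) ^ 2 = 4 * ‖x‖ ^ 2 := by
  rw [(hasFDerivAt_norm_sq_inner x).fderiv]
  simp only [FunLike.coe_smul, Pi.smul_apply, innerSL_apply_apply, smul_eq_mul, mul_pow,
    ← Finset.mul_sum]
  rw [← real_inner_self_eq_norm_sq, ← b.sum_inner_mul_inner x x]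
  norm_num
  refine Finset.sum_congr rfl fun i _ => ?_
  rw [real_inner_comm x, sq]

omit [FiniteDimensional ℝ E] in
theorem hasFDerivAt_rpow_norm_sq (p : ℝ) {x : E} (hx : x ≠ 0) :
    HasFDerivAt (fun y : E => (‖y‖ ^ 2) ^ p)
      ((p * (‖x‖ ^ 2) ^ (p - 1)) • (2 : ℝ) • innerSL ℝ x) x :=
  (Real.hasDerivAt_rpow_const (Or.inl (by simpa using hx))).comp_hasFDerivAt x
    (hasFDerivAt_norm_sq_inner x)

omit [FiniteDimensional ℝ E] in
theorem contDiffAt_rpow_norm_sq (p : ℝ) {x : E} (hx : x ≠ 0) {k : ℕ∞ω} :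
    ContDiffAt ℝ k (fun y : E => (‖y‖ ^ 2) ^ p) x :=
  (contDiff_norm_sq ℝ).contDiffAt.rpow_const_of_ne (by simpa using hx)

theorem laplacian_rpow_norm_sq (p : ℝ) {x : E} (hx : ‖x‖ = 1) :
    Δ (fun y : E => (‖y‖ ^ 2) ^ p) x = p * (4 * (p - 1) + 2 * Module.finrank ℝ E) := by
  have hs : ‖x‖ ^ 2 ≠ 0 := by simp [hx]
  have h1 : ∀ᶠ s in 𝓝 (‖x‖ ^ 2), HasDerivAt (fun s : ℝ => s ^ p) (p * s ^ (p - 1)) s :=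
    (eventually_ne_nhds hs).mono fun s h => Real.hasDerivAt_rpow_const (Or.inl h)
  have h2 : HasDerivAt (fun s : ℝ => p * s ^ (p - 1)) (p * ((p - 1) * (‖x‖ ^ 2) ^ (p - 1 - 1)))
      (‖x‖ ^ 2) := (Real.hasDerivAt_rpow_const (Or.inl hs)).const_mul p
  rw [laplacian_comp (stdOrthonormalBasis ℝ E) (contDiff_norm_sq ℝ).contDiffAt h1 h2,
    sum_fderiv_norm_sq_sq, laplacian_norm_sq, hx]
  simp
  ring

/-- The function `x ↦ (1 - ⟪v, x⟫ / ‖x‖) / 2`, constant along rays, whose value at a point of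
the unit sphere is a quarter of the squared distance to the unit vector `v`. -/
noncomputable def zonalCoord (v x : E) : ℝ := (1 - inner ℝ v x / ‖x‖) / 2

-- As a linear functional times a power of the smooth function ‖x‖², the quotient falls under the
-- product rule.
omit [FiniteDimensional ℝ E] in
theorem inner_div_norm_eq (v x : E) :
    inner ℝ v x / ‖x‖ = innerSL ℝ v x * (‖x‖ ^ 2) ^ (-1 / 2 : ℝ) := by
  rw [← Real.rpow_natCast, ← Real.rpow_mul (norm_nonneg x)]
  norm_num [Real.rpow_neg_one, div_eq_mul_inv]

omit [FiniteDimensional ℝ E] in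
theorem contDiffAt_inner_div_norm (v : E) {x : E} (hx : x ≠ 0) {k : ℕ∞ω} :
    ContDiffAt ℝ k (fun y : E => inner ℝ v y / ‖y‖) x := by
  simp only [inner_div_norm_eq]
  exact (innerSL ℝ v).contDiff.contDiffAt.mul (contDiffAt_rpow_norm_sq _ hx)

-- The radial derivative vanishes, so the gradient at a unit vector is the tangential projection of
-- `v`.
omit [FiniteDimensional ℝ E] in
theorem fderiv_inner_div_norm (v : E) {x : E} (hx : ‖x‖ = 1) :
    fderiv ℝ (fun y : E => inner ℝ v y / ‖y‖) x = innerSL ℝ (v - (inner ℝ v x : ℝ) • x) := by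
  have hx0 : x ≠ 0 := by rintro rfl; simp at hx
  simp only [inner_div_norm_eq]
  refine ((innerSL ℝ v).hasFDerivAt.mul (hasFDerivAt_rpow_norm_sq _ hx0)).fderiv.trans ?_
  rw [hx]
  ext z
  simp
  ring

theorem laplacian_inner_div_norm (v : E) {x : E} (hx : ‖x‖ = 1) :
    Δ (fun y : E => inner ℝ v y / ‖y‖) x = -(Module.finrank ℝ E - 1) * inner ℝ v x := by
  have hx0 : x ≠ 0 := by rintro rfl; simp at hx
  let b := stdOrthonormalBasis ℝ E
  simp only [inner_div_norm_eq]
  rw [laplacian_mul b (innerSL ℝ v).contDiff.contDiffAt (contDiffAt_rpow_norm_sq _ hx0),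
    laplacian_rpow_norm_sq _ hx, (hasFDerivAt_rpow_norm_sq _ hx0).fderiv,
    (innerSL ℝ v).hasFDerivAt.fderiv,
    laplacian_eq_sum_of_hasFDerivAt b (Eventually.of_forall fun y => (innerSL ℝ v).hasFDerivAt)
      (hasFDerivAt_const _ _)]
  have key : ∑ i, (inner ℝ v (b i) : ℝ) * inner ℝ x (b i) = inner ℝ v x := by
    rw [← b.sum_inner_mul_inner v x]
    exact Finset.sum_congr rfl fun i _ => by rw [real_inner_comm x]
  have key2 : ∑ i, innerSL ℝ v (b i) * ((-1 / 2 * (‖x‖ ^ 2) ^ (-1 / 2 - 1 : ℝ)) •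
      (2 : ℝ) • innerSL ℝ x) (b i) = - inner ℝ v x := by
    rw [hx, ← key, ← Finset.sum_neg_distrib]
    refine Finset.sum_congr rfl fun i _ => ?_
    simp
    ring
  rw [key2]
  simp
  ring

omit [FiniteDimensional ℝ E] in
theorem sum_fderiv_inner_div_norm_sq {ι : Type*} [Fintype ι] (b : OrthonormalBasis ι ℝ E)
    {v x : E} (hv : ‖v‖ = 1) (hx : ‖x‖ = 1) :
    ∑ i, fderiv ℝ (fun y : E => inner ℝ v y / ‖y‖) x (b i) ^ 2 = 1 - (inner ℝ v x : ℝ) ^ 2 := by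
  rw [fderiv_inner_div_norm v hx]
  simp only [innerSL_apply_apply]
  set a := v - (inner ℝ v x : ℝ) • x with ha
  have : ∑ i, (inner ℝ a (b i) : ℝ) ^ 2 = inner ℝ a a := by
    rw [← b.sum_inner_mul_inner a a]
    exact Finset.sum_congr rfl fun i _ => by rw [real_inner_comm a, sq]
  rw [this, ha, inner_sub_left, inner_sub_right, inner_sub_right]
  simp only [inner_smul_left, inner_smul_right, real_inner_self_eq_norm_sq, hv, hx,
    real_inner_comm v x, RCLike.conj_to_real]
  ring

omit [FiniteDimensional ℝ E] in
theorem contDiffAt_zonalCoord (v : E) {x : E} (hx : x ≠ 0) {k : ℕ∞ω} :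
    ContDiffAt ℝ k (zonalCoord v) x :=
  (contDiffAt_const.sub (contDiffAt_inner_div_norm v hx)).div_const 2

/-- Chain rule in s = ⟨v, x⟩, whose spherical gradient has squared length 1 - s² and whose spherical
Laplacian is -(dim E - 1)s. With z = (1-s)/2 one has 1 - s² = 4z(1-z) and s = 1 - 2z. -/
theorem laplacian_polynomial_zonalCoord (P : Polynomial ℝ) {v x : E} (hv : ‖v‖ = 1)
    (hx : ‖x‖ = 1) :
    Δ (fun y => P.eval (zonalCoord v y)) x
      = zonalCoord v x * (1 - zonalCoord v x) * P.derivative.derivative.eval (zonalCoord v x)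
        + (Module.finrank ℝ E - 1) / 2 * (1 - 2 * zonalCoord v x)
          * P.derivative.eval (zonalCoord v x) := by
  have hx0 : x ≠ 0 := by rintro rfl; simp at hx
  have hd : ∀ s : ℝ, HasDerivAt (fun s : ℝ => (1 - s) / 2) (-1 / 2) s := fun s =>
    ((hasDerivAt_id s).const_sub 1).div_const 2
  have h1 : ∀ s : ℝ, HasDerivAt (fun s => P.eval ((1 - s) / 2))
      (P.derivative.eval ((1 - s) / 2) * (-1 / 2)) s := fun s =>
    (P.hasDerivAt _).comp s (hd s)
  have h2 : ∀ s : ℝ, HasDerivAt (fun s => P.derivative.eval ((1 - s) / 2) * (-1 / 2))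
      (P.derivative.derivative.eval ((1 - s) / 2) * (-1 / 2) * (-1 / 2)) s := fun s =>
    ((P.derivative.hasDerivAt _).comp s (hd s)).mul_const _
  have := laplacian_comp (stdOrthonormalBasis ℝ E) (contDiffAt_inner_div_norm v hx0)
    (Eventually.of_forall h1) (h2 _)
  simp only [zonalCoord]
  rw [this, sum_fderiv_inner_div_norm_sq _ hv hx, laplacian_inner_div_norm v hx, hx]
  simp only [div_one]
  ring

end EuclideanLaplacian

/-! ### Extension along rays and zonal functions on the sphere -/

section RayExtension

open Laplacian InnerProductSpace Filter Topology Metric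

variable {n : ℕ}

theorem USphere.norm_coe (q : USphere n) : ‖(q : Ambient n)‖ = 1 := by simp

theorem USphere.coe_ne_zero (q : USphere n) : (q : Ambient n) ≠ 0 := ne_zero_of_mem_unit_sphere q

theorem rayExtension_of_ne_zero (φ : USphere n → ℝ) {x : Ambient n} (hx : x ≠ 0) :
    rayExtension φ x = φ (radialProj x hx) := by simp [rayExtension, hx]

theorem radialProj_coe (q : USphere n) (hq : (q : Ambient n) ≠ 0) :
    radialProj (q : Ambient n) hq = q := by
  ext1; simp [radialProj]

theorem radialProj_smul {c : ℝ} (hc : 0 < c) {x : Ambient n} (hx : x ≠ 0) (hcx : c • x ≠ 0) :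
    radialProj (c • x) hcx = radialProj x hx := by
  ext1
  simp only [radialProj, norm_smul, Real.norm_eq_abs, abs_of_pos hc, mul_inv, smul_smul]
  congr 1
  field_simp

theorem rayExtension_smul (φ : USphere n → ℝ) {c : ℝ} (hc : 0 < c) (x : Ambient n) :
    rayExtension φ (c • x) = rayExtension φ x := by
  by_cases hx : x = 0
  · simp [hx]
  · rw [rayExtension_of_ne_zero φ hx, rayExtension_of_ne_zero φ (smul_ne_zero hc.ne' hx),
      radialProj_smul hc hx]

/-- Off the origin the extension is φ composed with radial projection, which is smooth from the open
submanifold {0}ᶜ to the sphere. -/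
theorem contDiffAt_rayExtension {φ : USphere n → ℝ} (hφ : ContMDiff (𝓡 n) 𝓘(ℝ, ℝ) ∞ φ)
    {x : Ambient n} (hx : x ≠ 0) : ContDiffAt ℝ ∞ (rayExtension φ) x := by
  have := Fact.mk (@finrank_euclideanSpace_fin ℝ _ (n + 1))
  let U : TopologicalSpace.Opens (Ambient n) := ⟨{0}ᶜ, isOpen_compl_singleton⟩
  have h1 : ContMDiff 𝓘(ℝ, Ambient n) 𝓘(ℝ, Ambient n) ∞
      (fun y : U => ‖(y : Ambient n)‖⁻¹ • (y : Ambient n)) := by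
    intro y
    refine (contMDiffAt_subtype_iff (U := U)
      (f := fun z : Ambient n => ‖z‖⁻¹ • z)).2 (ContDiffAt.contMDiffAt ?_)
    exact ((contDiffAt_norm ℝ y.2).inv (norm_ne_zero_iff.2 y.2)).smul contDiffAt_id
  have h2 := hφ.comp (ContMDiff.codRestrict_sphere (n := n) h1
    (fun y => (radialProj (y : Ambient n) y.2).2))
  have h3 : ContMDiffAt 𝓘(ℝ, Ambient n) 𝓘(ℝ, ℝ) ∞ (rayExtension φ) ((⟨x, hx⟩ : U) : Ambient n) := by
    refine (contMDiffAt_subtype_iff (U := U)).1 ?_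
    refine (h2 ⟨x, hx⟩).congr_of_eventuallyEq (Eventually.of_forall fun y => ?_)
    exact rayExtension_of_ne_zero φ y.2
  exact h3.contDiffAt

/-- The Laplacian of a function homogeneous of degree 0 is homogeneous of degree -2. -/
theorem laplacian_of_ray_invariant {f : Ambient n → ℝ}
    (hf : ∀ x ≠ 0, ContDiffAt ℝ ∞ f x) (hinv : ∀ c : ℝ, 0 < c → ∀ x, f (c • x) = f x)
    {x : Ambient n} (hx : x ≠ 0) :
    Δ f x = (‖x‖ ^ 2)⁻¹ * Δ f (radialProj x hx : Ambient n) := by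
  have hc : 0 < ‖x‖⁻¹ := inv_pos.2 (norm_pos_iff.2 hx)
  have h := laplacian_comp_smul (f := f) (x := x) (c := ‖x‖⁻¹)
    ((hf _ (smul_ne_zero hc.ne' hx)).of_le (WithTop.coe_le_coe.2 le_top))
  simp only [hinv _ hc] at h
  rw [h, inv_pow]
  rfl

/-- The coordinate `(1 - ⟪v, q⟫) / 2` of a point `q` of the sphere with respect to the pole `v`. -/
noncomputable def poleCoord (v q : USphere n) : ℝ := (1 - inner ℝ (v : Ambient n) (q : Ambient n)) / 2

theorem zonalCoord_coe (v q : USphere n) :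
    zonalCoord (v : Ambient n) (q : Ambient n) = poleCoord v q := by
  simp [zonalCoord, poleCoord]

theorem poleCoord_comm (v q : USphere n) : poleCoord v q = poleCoord q v := by
  rw [poleCoord, poleCoord, real_inner_comm]

theorem zonalCoord_smul (v : Ambient n) {c : ℝ} (hc : 0 < c) (x : Ambient n) :
    zonalCoord v (c • x) = zonalCoord v x := by
  by_cases hx : x = 0
  · simp [hx]
  simp only [zonalCoord, inner_smul_right, norm_smul, Real.norm_eq_abs, abs_of_pos hc]
  rw [mul_div_mul_left _ _ hc.ne']

theorem zonalCoord_eq_poleCoord (v : USphere n) {x : Ambient n} (hx : x ≠ 0) :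
    zonalCoord (v : Ambient n) x = poleCoord v (radialProj x hx) := by
  rw [← zonalCoord_coe, radialProj, zonalCoord_smul _ (inv_pos.2 (norm_pos_iff.2 hx))]

@[fun_prop]
theorem continuous_poleCoord (v : USphere n) : Continuous (poleCoord v) := by
  unfold poleCoord; fun_prop

/-- The operator `P ↦ -(x (1 - x) P'' + (n / 2) (1 - 2 x) P')` on polynomials, which is the
Laplace-Beltrami operator on functions of `poleCoord v`. -/
noncomputable def zonalOp (n : ℕ) (P : Polynomial ℝ) : Polynomial ℝ :=
  -(Polynomial.X * (1 - Polynomial.X) * P.derivative.derivative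
    + Polynomial.C ((n : ℝ) / 2) * (1 - 2 * Polynomial.X) * P.derivative)

theorem eval_zonalOp (P : Polynomial ℝ) (x : ℝ) : (zonalOp n P).eval x
    = -(x * (1 - x) * P.derivative.derivative.eval x
      + (n : ℝ) / 2 * (1 - 2 * x) * P.derivative.eval x) := by
  simp [zonalOp]

theorem contMDiff_polynomial_poleCoord (P : Polynomial ℝ) (v : USphere n) :
    ContMDiff (𝓡 n) 𝓘(ℝ, ℝ) ∞ (fun q => P.eval (poleCoord v q)) := by
  have h : ContDiff ℝ ∞ (fun x : Ambient n => P.eval ((1 - inner ℝ (v : Ambient n) x) / 2)) := by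
    have hP : ContDiff ℝ ∞ (fun t => P.eval t) := by
      simpa using P.contDiff_aeval (𝕜 := ℝ) (n := ∞)
    exact hP.comp ((contDiff_const.sub (contDiff_const.inner ℝ contDiff_id)).div_const 2)
  have := Fact.mk (@finrank_euclideanSpace_fin ℝ _ (n + 1))
  exact h.contMDiff.comp contMDiff_coe_sphere

theorem rayExtension_polynomial (P : Polynomial ℝ) (v : USphere n) {x : Ambient n} (hx : x ≠ 0) :
    rayExtension (fun q => P.eval (poleCoord v q)) x = P.eval (zonalCoord (v : Ambient n) x) := by
  rw [rayExtension_of_ne_zero _ hx, zonalCoord_eq_poleCoord v hx]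

theorem laplacian_polynomial_zonal (P : Polynomial ℝ) (v q : USphere n) :
    Δ (fun y => P.eval (zonalCoord (v : Ambient n) y)) (q : Ambient n)
      = -(zonalOp n P).eval (poleCoord v q) := by
  rw [laplacian_polynomial_zonalCoord P v.norm_coe q.norm_coe, eval_zonalOp, zonalCoord_coe]
  simp

theorem laplaceBeltrami_polynomial (P : Polynomial ℝ) (v q : USphere n) :
    laplaceBeltrami (fun q => P.eval (poleCoord v q)) q = (zonalOp n P).eval (poleCoord v q) := by
  have h : rayExtension (fun q => P.eval (poleCoord v q)) =ᶠ[𝓝 (q : Ambient n)]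
      fun y => P.eval (zonalCoord (v : Ambient n) y) :=
    (eventually_ne_nhds q.coe_ne_zero).mono fun y hy => rayExtension_polynomial P v hy
  rw [laplaceBeltrami, (laplacian_congr_nhds h).self_of_nhds, laplacian_polynomial_zonal, neg_neg]

end RayExtension

/-! ### Polar coordinates and radial cutoffs -/

section PolarCoordinates

open Laplacian InnerProductSpace Filter Topology Metric Set

variable {n : ℕ}

theorem integrable_volumeIoiPow {b : ℝ → ℝ} (hb : Continuous b) (hc : HasCompactSupport b)
    (k : ℕ) : Integrable (fun r : Ioi (0 : ℝ) => b r) (Measure.volumeIoiPow k) := by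
  have h : IntegrableOn (fun r : ℝ => r ^ k * b r) (Ioi 0) :=
    ((by fun_prop : Continuous fun r : ℝ => r ^ k * b r).integrable_of_hasCompactSupport
      hc.mul_left).integrableOn
  rw [integrableOn_iff_comap_subtypeVal measurableSet_Ioi] at h
  rw [Measure.volumeIoiPow, integrable_withDensity_iff_integrable_smul' (by fun_prop) (by simp)]
  refine h.congr (Eventually.of_forall fun r => ?_)
  have hr : (0 : ℝ) < r := r.2
  simp [ENNReal.toReal_ofReal (pow_nonneg hr.le k)]

instance : IsFiniteMeasure (sphereMeasure n) := by unfold sphereMeasure; infer_instance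

instance : (sphereMeasure n).IsOpenPosMeasure := by unfold sphereMeasure; infer_instance

theorem sphereMeasure_ne_zero : sphereMeasure n ≠ 0 := Measure.toSphere_ne_zero _

theorem sphereVol_pos : 0 < sphereVol n := by
  have : NeZero (sphereMeasure n) := ⟨sphereMeasure_ne_zero⟩
  exact measureReal_univ_pos

theorem continuous_integrable_sphere {a : USphere n → ℝ} (ha : Continuous a) :
    Integrable a (sphereMeasure n) :=
  ha.integrable_of_hasCompactSupport (HasCompactSupport.of_compactSpace a)

/-- Two separated terms are needed because the Laplacian of a radial function times an angular one
has an angular and a radial contribution. -/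
theorem integral_polar {f : Ambient n → ℝ} {a₁ a₂ : USphere n → ℝ} {b₁ b₂ : ℝ → ℝ}
    (ha₁ : Continuous a₁) (ha₂ : Continuous a₂) (hb₁ : Continuous b₁) (hb₂ : Continuous b₂)
    (hc₁ : HasCompactSupport b₁) (hc₂ : HasCompactSupport b₂)
    (hf : ∀ (x : Ambient n) (hx : x ≠ 0),
      f x = a₁ (radialProj x hx) * b₁ ‖x‖ + a₂ (radialProj x hx) * b₂ ‖x‖) :
    ∫ x, f x = (∫ q, a₁ q ∂(sphereMeasure n)) * (∫ r : Ioi (0 : ℝ), b₁ r ∂.volumeIoiPow n)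
      + (∫ q, a₂ q ∂(sphereMeasure n)) * (∫ r : Ioi (0 : ℝ), b₂ r ∂.volumeIoiPow n) := by
  have hfin : Module.finrank ℝ (Ambient n) - 1 = n := by simp
  calc
    ∫ x, f x = ∫ x : ({(0)}ᶜ : Set (Ambient n)), f x.1 ∂((volume : Measure (Ambient n)).comap (↑)) := by
      rw [integral_subtype_comap (measurableSet_singleton _).compl f, restrict_compl_singleton]
    _ = ∫ z : USphere n × Ioi (0 : ℝ), (a₁ z.1 * b₁ z.2 + a₂ z.1 * b₂ z.2)
          ∂(sphereMeasure n).prod (.volumeIoiPow n) := by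
      have := (volume : Measure (Ambient n)).measurePreserving_homeomorphUnitSphereProd.integral_comp
        (Homeomorph.measurableEmbedding _)
        (fun z : USphere n × Ioi (0 : ℝ) => a₁ z.1 * b₁ z.2 + a₂ z.1 * b₂ z.2)
      rw [hfin] at this
      rw [sphereMeasure, ← this]
      refine integral_congr_ae (Eventually.of_forall fun x => ?_)
      dsimp only
      rw [hf x.1 x.2]
      have : (homeomorphUnitSphereProd (Ambient n) x).1 = radialProj x.1 x.2 := by
        ext1; simp [radialProj]
      simp [this]
    _ = _ := by
      rw [integral_add
        ((continuous_integrable_sphere ha₁).mul_prod (integrable_volumeIoiPow hb₁ hc₁ n))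
        ((continuous_integrable_sphere ha₂).mul_prod (integrable_volumeIoiPow hb₂ hc₂ n))]
      exact congrArg₂ _ (integral_prod_mul a₁ fun r : Ioi (0 : ℝ) => b₁ r)
        (integral_prod_mul a₂ fun r : Ioi (0 : ℝ) => b₂ r)

/-- Smoothness and compact support of the product of a function that is smooth away from the
origin with a radial cutoff function. -/
theorem cutoff_mul {ρ : ℝ → ℝ} (hρ : ContDiff ℝ ∞ ρ) (hs : ∀ s, s ∉ Icc (1 / 4 : ℝ) (7 / 4) → ρ s = 0)
    {g : Ambient n → ℝ} (hg : ∀ x ≠ 0, ContDiffAt ℝ ∞ g x) :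
    ContDiff ℝ ∞ (fun x => ρ (‖x‖ ^ 2) * g x) ∧ HasCompactSupport (fun x => ρ (‖x‖ ^ 2) * g x) := by
  constructor
  · rw [contDiff_iff_contDiffAt]
    intro x
    by_cases hx : x = 0
    · have : (fun x => ρ (‖x‖ ^ 2) * g x) =ᶠ[𝓝 x] fun _ => 0 := by
        have hc : ContinuousAt (fun x : Ambient n => ‖x‖ ^ 2) x := by fun_prop
        have : ∀ᶠ y in 𝓝 x, ‖y‖ ^ 2 < 1 / 4 := hc.eventually_lt continuousAt_const (by simp [hx])
        filter_upwards [this] with y hy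
        rw [hs _ (fun h => by linarith [h.1]), zero_mul]
      exact contDiffAt_const.congr_of_eventuallyEq this
    · exact (hρ.comp (contDiff_norm_sq ℝ)).contDiffAt.mul (hg x hx)
  · refine HasCompactSupport.intro (isCompact_closedBall (0 : Ambient n) 2) fun x hx => ?_
    rw [mem_closedBall_zero_iff, not_le] at hx
    rw [hs _ (fun h => by nlinarith [h.2]), zero_mul]

theorem hasCompactSupport_comp_sq {ρ : ℝ → ℝ} (hs : ∀ s, s ∉ Icc (1 / 4 : ℝ) (7 / 4) → ρ s = 0) :
    HasCompactSupport fun r : ℝ => ρ (r ^ 2) := by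
  refine HasCompactSupport.intro (isCompact_closedBall (0 : ℝ) 2) fun x hx => ?_
  rw [mem_closedBall_zero_iff, not_le, Real.norm_eq_abs] at hx
  exact hs _ (fun h => by nlinarith [h.2, sq_abs x])

theorem laplacian_radial {ρ : ℝ → ℝ} (hρ : ContDiff ℝ ∞ ρ) (x : Ambient n) :
    Δ (fun y : Ambient n => ρ (‖y‖ ^ 2)) x
      = 4 * ‖x‖ ^ 2 * deriv (deriv ρ) (‖x‖ ^ 2) + 2 * (n + 1) * deriv ρ (‖x‖ ^ 2) := by
  have h1 : ∀ s, HasDerivAt ρ (deriv ρ s) s := fun s =>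
    (hρ.differentiable (by simp) s).hasDerivAt
  have h2 : HasDerivAt (deriv ρ) (deriv (deriv ρ) (‖x‖ ^ 2)) (‖x‖ ^ 2) :=
    ((contDiff_infty_iff_deriv.1 hρ).2.differentiable (by simp) _).hasDerivAt
  rw [laplacian_comp (stdOrthonormalBasis ℝ (Ambient n)) (contDiff_norm_sq ℝ).contDiffAt
    (Eventually.of_forall h1) h2, sum_fderiv_norm_sq_sq, laplacian_norm_sq]
  simp
  ring

theorem fderiv_apply_self_of_ray_invariant {f : Ambient n → ℝ} {x : Ambient n}
    (hf : DifferentiableAt ℝ f x) (hinv : ∀ c : ℝ, 0 < c → ∀ x, f (c • x) = f x) :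
    fderiv ℝ f x x = 0 := by
  have hl : HasDerivAt (fun c : ℝ => c • x) ((1 : ℝ) • x) 1 := (hasDerivAt_id 1).smul_const x
  have h1 : HasDerivAt (fun c : ℝ => f (c • x)) (fderiv ℝ f x ((1 : ℝ) • x)) 1 := by
    refine HasFDerivAt.comp_hasDerivAt (1 : ℝ) ?_ hl
    simpa using hf.hasFDerivAt
  have h2 : (fun c : ℝ => f (c • x)) =ᶠ[𝓝 1] fun _ => f x :=
    (eventually_gt_nhds one_pos).mono fun c hc => hinv c hc x
  have := h1.unique ((hasDerivAt_const (1 : ℝ) (f x)).congr_of_eventuallyEq h2)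
  simpa using this

/-- The cross term of the product rule vanishes: the gradient of a radial function points along x,
and `f` is constant in that direction. -/
theorem laplacian_radial_mul {ρ : ℝ → ℝ} (hρ : ContDiff ℝ ∞ ρ) {f : Ambient n → ℝ}
    {x : Ambient n} (hf : ContDiffAt ℝ 2 f x) (hinv : ∀ c : ℝ, 0 < c → ∀ x, f (c • x) = f x) :
    Δ (fun y => ρ (‖y‖ ^ 2) * f y) x = ρ (‖x‖ ^ 2) * Δ f x
      + f x * (4 * ‖x‖ ^ 2 * deriv (deriv ρ) (‖x‖ ^ 2) + 2 * (n + 1) * deriv ρ (‖x‖ ^ 2)) := by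
  let b := stdOrthonormalBasis ℝ (Ambient n)
  have hρ2 : ContDiffAt ℝ 2 (fun y : Ambient n => ρ (‖y‖ ^ 2)) x :=
    ((hρ.comp (contDiff_norm_sq ℝ)).of_le (WithTop.coe_le_coe.2 le_top)).contDiffAt
  have hd : fderiv ℝ (fun y : Ambient n => ρ (‖y‖ ^ 2)) x
      = deriv ρ (‖x‖ ^ 2) • (2 : ℝ) • innerSL ℝ x :=
    (((hρ.differentiable (by simp) _).hasDerivAt).comp_hasFDerivAt x
      (hasFDerivAt_norm_sq_inner x)).fderiv
  have hz : ∑ i, fderiv ℝ (fun y : Ambient n => ρ (‖y‖ ^ 2)) x (b i) * fderiv ℝ f x (b i) = 0 := by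
    calc _ = deriv ρ (‖x‖ ^ 2) * 2 * ∑ i, fderiv ℝ f x ((inner ℝ (b i) x : ℝ) • b i) := by
          rw [Finset.mul_sum]
          refine Finset.sum_congr rfl fun i _ => ?_
          rw [hd, map_smul, real_inner_comm]
          simp
          ring
      _ = 0 := by
          rw [← map_sum, b.sum_repr' x, fderiv_apply_self_of_ray_invariant
            (hf.differentiableAt (by simp)) hinv, mul_zero]
  rw [laplacian_mul b hρ2 hf, hz, laplacian_radial hρ]
  ring

end PolarCoordinates

/-! ### Symmetry of the Laplace-Beltrami operator -/

section SelfAdjoint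

open Laplacian InnerProductSpace Filter Topology Metric Set

variable {n : ℕ}

/-- A smooth bump function equal to `1` near `1`. -/
noncomputable def innerBump : ContDiffBump (1 : ℝ) := ⟨1 / 4, 1 / 2, by norm_num, by norm_num⟩

/-- A smooth bump function equal to `1` on the support of `innerBump`. -/
noncomputable def outerBump : ContDiffBump (1 : ℝ) := ⟨1 / 2, 3 / 4, by norm_num, by norm_num⟩

theorem innerBump_eq_zero {s : ℝ} (hs : s ∉ ball (1 : ℝ) (1 / 2)) : innerBump s = 0 := by
  by_contra h
  have : s ∈ Function.support innerBump := h
  rw [innerBump.support_eq] at this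
  exact hs this

theorem outerBump_eq_one {s : ℝ} (hs : s ∈ closedBall (1 : ℝ) (1 / 2)) : outerBump s = 1 :=
  outerBump.one_of_mem_closedBall hs

theorem outerBump_eq_zero {s : ℝ} (hs : s ∉ Icc (1 / 4 : ℝ) (7 / 4)) : outerBump s = 0 := by
  by_contra h
  have : s ∈ Function.support outerBump := h
  rw [outerBump.support_eq, Real.ball_eq_Ioo] at this
  refine hs (Ioo_subset_Icc_self ?_)
  convert this using 2 <;> norm_num [outerBump]

theorem innerBump_eq_zero' {s : ℝ} (hs : s ∉ Icc (1 / 4 : ℝ) (7 / 4)) : innerBump s = 0 := by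
  refine innerBump_eq_zero fun h => hs ?_
  rw [Real.ball_eq_Ioo] at h
  constructor <;> linarith [h.1, h.2]

/-- The smooth radial weight `s ↦ s * innerBump s`, as a function of `s = ‖x‖ ^ 2`. -/
noncomputable def radialWeight (s : ℝ) : ℝ := s * innerBump s

theorem contDiff_radialWeight : ContDiff ℝ ∞ radialWeight := contDiff_id.mul innerBump.contDiff

theorem radialWeight_eventually_zero {s : ℝ} (hs : s ∉ closedBall (1 : ℝ) (1 / 2)) :
    radialWeight =ᶠ[𝓝 s] fun _ => 0 := by
  filter_upwards [isClosed_closedBall.isOpen_compl.mem_nhds hs] with t ht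
  rw [radialWeight, innerBump_eq_zero fun h => ht (ball_subset_closedBall h), mul_zero]

/-- The Laplacian of `x ↦ radialWeight (‖x‖ ^ 2)`, as a function of `s = ‖x‖ ^ 2`. -/
noncomputable def radialWeightLaplacian (n : ℕ) (s : ℝ) : ℝ :=
  4 * s * deriv (deriv radialWeight) s + 2 * (n + 1) * deriv radialWeight s

theorem continuous_radialWeightLaplacian : Continuous (radialWeightLaplacian n) := by
  have h1 := (contDiff_infty_iff_deriv.1 contDiff_radialWeight).2
  have h2 := (contDiff_infty_iff_deriv.1 h1).2
  have := h1.continuous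
  have := h2.continuous
  unfold radialWeightLaplacian
  fun_prop

theorem radialWeightLaplacian_eq_zero {s : ℝ} (hs : s ∉ closedBall (1 : ℝ) (1 / 2)) :
    radialWeightLaplacian n s = 0 := by
  have h := radialWeight_eventually_zero hs
  have h1 := h.deriv
  have h2 := h1.deriv
  rw [radialWeightLaplacian, h1.self_of_nhds, h2.self_of_nhds]
  simp

/-- The smooth function on `ℝ^{n+1}` that agrees with the ray extension of `φ` near the sphere. -/
theorem exists_schwartz_outer {φ : USphere n → ℝ} (hφ : ContMDiff (𝓡 n) 𝓘(ℝ, ℝ) ∞ φ) :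
    ∃ g : SchwartzMap (Ambient n) ℝ, ∀ x, g x = outerBump (‖x‖ ^ 2) * rayExtension φ x := by
  have h := cutoff_mul (n := n) outerBump.contDiff (fun s hs => outerBump_eq_zero hs)
    (fun x hx => contDiffAt_rayExtension hφ hx)
  exact ⟨h.2.toSchwartzMap h.1, fun x => rfl⟩

theorem laplacian_schwartz_outer {φ : USphere n → ℝ} {g : SchwartzMap (Ambient n) ℝ}
    (hg : ∀ x, g x = outerBump (‖x‖ ^ 2) * rayExtension φ x) {x : Ambient n}
    (hx : ‖x‖ ^ 2 ∈ ball (1 : ℝ) (1 / 2)) : Δ g x = Δ (rayExtension φ) x := by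
  rw [SchwartzMap.laplacian_apply]
  refine (laplacian_congr_nhds ?_).self_of_nhds
  have hc : ContinuousAt (fun x : Ambient n => ‖x‖ ^ 2) x := by fun_prop
  filter_upwards [hc.preimage_mem_nhds (isOpen_ball.mem_nhds hx)] with y hy
  rw [hg, outerBump_eq_one (ball_subset_closedBall hy), one_mul]

/-- Near the sphere the ray extension coincides with a Schwartz function, whose Laplacian is
continuous. -/
theorem continuous_laplaceBeltrami {φ : USphere n → ℝ} (hφ : ContMDiff (𝓡 n) 𝓘(ℝ, ℝ) ∞ φ) :
    Continuous (laplaceBeltrami φ) := by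
  obtain ⟨g, hg⟩ := exists_schwartz_outer hφ
  have : laplaceBeltrami φ = fun q => -(Δ g) (q : Ambient n) := by
    ext q
    rw [laplacian_schwartz_outer hg (by simp), laplaceBeltrami]
  rw [this]
  fun_prop

/-- Euclidean integration by parts for u = ρ(‖x‖²)P and g = χ(‖x‖²)φ, separated in polar
coordinates. The factor s in `radialWeight` cancels the ‖x‖⁻² of the Laplacian of a ray-invariant
function, so the same weight `innerBump` appears on both sides; χ = 1 wherever ρ ≠ 0. The
derivatives of ρ leave the last term. -/
theorem green_identity_with_weights {φ : USphere n → ℝ} (hφ : ContMDiff (𝓡 n) 𝓘(ℝ, ℝ) ∞ φ)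
    (P : Polynomial ℝ) (v : USphere n) :
    (∫ q, P.eval (poleCoord v q) * laplaceBeltrami φ q ∂(sphereMeasure n))
        * (∫ r : Ioi (0 : ℝ), innerBump ((r : ℝ) ^ 2) ∂.volumeIoiPow n)
      = (∫ q, (zonalOp n P).eval (poleCoord v q) * φ q ∂(sphereMeasure n))
        * (∫ r : Ioi (0 : ℝ), innerBump ((r : ℝ) ^ 2) ∂.volumeIoiPow n)
      - (∫ q, P.eval (poleCoord v q) * φ q ∂(sphereMeasure n))
        * (∫ r : Ioi (0 : ℝ), radialWeightLaplacian n ((r : ℝ) ^ 2) ∂.volumeIoiPow n) := by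
  have hφc : Continuous φ := hφ.continuous
  have hφL := continuous_laplaceBeltrami hφ
  obtain ⟨g, hg⟩ := exists_schwartz_outer hφ
  have hsm : ∀ x : Ambient n, x ≠ 0 →
      ContDiffAt ℝ ∞ (fun x => P.eval (zonalCoord (v : Ambient n) x)) x := fun x hx => by
    have hP : ContDiff ℝ ∞ (fun t => P.eval t) := by
      simpa using P.contDiff_aeval (𝕜 := ℝ) (n := ∞)
    exact hP.contDiffAt.comp x (contDiffAt_zonalCoord _ hx)
  have hinv : ∀ c : ℝ, 0 < c → ∀ x,
      P.eval (zonalCoord (v : Ambient n) (c • x)) = P.eval (zonalCoord (v : Ambient n) x) :=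
    fun c hc x => by rw [zonalCoord_smul _ hc]
  have hu := cutoff_mul (n := n) contDiff_radialWeight
    (fun s hs => by rw [radialWeight, innerBump_eq_zero' hs, mul_zero]) hsm
  let u : SchwartzMap (Ambient n) ℝ := hu.2.toSchwartzMap hu.1
  have hux : ∀ x, u x = radialWeight (‖x‖ ^ 2) * P.eval (zonalCoord (v : Ambient n) x) :=
    fun x => rfl
  have hparts := SchwartzMap.integral_mul_laplacian_right_eq_left (μ := volume) u g
  have hb1 : Continuous fun r : ℝ => innerBump (r ^ 2) :=
    innerBump.continuous.comp (continuous_pow 2)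
  have hc1 : HasCompactSupport fun r : ℝ => innerBump (r ^ 2) :=
    hasCompactSupport_comp_sq fun s hs => innerBump_eq_zero' hs
  have hb2 : Continuous fun r : ℝ => radialWeightLaplacian n (r ^ 2) :=
    continuous_radialWeightLaplacian.comp (continuous_pow 2)
  have hc2 : HasCompactSupport fun r : ℝ => radialWeightLaplacian n (r ^ 2) :=
    hasCompactSupport_comp_sq fun s hs => radialWeightLaplacian_eq_zero fun h => hs <| by
      rw [Real.closedBall_eq_Icc] at h
      constructor <;> linarith [h.1, h.2]
  have hl := integral_polar (f := fun x => u x * Δ g x)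
    (a₁ := fun q => -(P.eval (poleCoord v q) * laplaceBeltrami φ q)) (a₂ := fun _ => 0)
    (by fun_prop) (by fun_prop) hb1 hb1 hc1 hc1 (fun x hx => by
      by_cases hs : ‖x‖ ^ 2 ∈ ball (1 : ℝ) (1 / 2)
      · have hx2 : ‖x‖ ^ 2 ≠ 0 := by simpa using hx
        rw [laplacian_schwartz_outer hg hs, hux, zonalCoord_eq_poleCoord v hx, radialWeight,
          laplacian_of_ray_invariant (fun x hx => contDiffAt_rayExtension hφ hx)
            (fun c hc x => rayExtension_smul φ hc x) hx, laplaceBeltrami]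
        field_simp
        ring
      · simp only [hux, radialWeight, innerBump_eq_zero hs]
        ring)
  have hr := integral_polar (f := fun x => Δ u x * g x)
    (a₁ := fun q => -((zonalOp n P).eval (poleCoord v q) * φ q))
    (a₂ := fun q => P.eval (poleCoord v q) * φ q)
    (by fun_prop) (by fun_prop) hb1 hb2 hc1 hc2 (fun x hx => by
      have hL : Δ u x = radialWeight (‖x‖ ^ 2) *
            ((‖x‖ ^ 2)⁻¹ * (-(zonalOp n P).eval (poleCoord v (radialProj x hx))))
          + P.eval (poleCoord v (radialProj x hx)) * radialWeightLaplacian n (‖x‖ ^ 2) := by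
        rw [SchwartzMap.laplacian_apply]
        refine (laplacian_radial_mul contDiff_radialWeight
          ((hsm x hx).of_le (WithTop.coe_le_coe.2 le_top)) hinv).trans ?_
        rw [laplacian_of_ray_invariant hsm hinv hx, laplacian_polynomial_zonal,
          zonalCoord_eq_poleCoord v hx, radialWeightLaplacian]
      rw [hL, hg, rayExtension_of_ne_zero φ hx]
      by_cases hs : ‖x‖ ^ 2 ∈ closedBall (1 : ℝ) (1 / 2)
      · have hx2 : ‖x‖ ^ 2 ≠ 0 := by simpa using hx
        rw [outerBump_eq_one hs, radialWeight]
        field_simp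
      · rw [radialWeightLaplacian_eq_zero hs,
          (radialWeight_eventually_zero hs).self_of_nhds,
          innerBump_eq_zero fun h => hs (ball_subset_closedBall h)]
        ring)
  rw [hl, hr] at hparts
  simp only [integral_neg, integral_zero] at hparts
  linarith

theorem integral_innerBump_pos :
    0 < ∫ r : Ioi (0 : ℝ), innerBump ((r : ℝ) ^ 2) ∂.volumeIoiPow n := by
  have hb1 : Continuous fun r : ℝ => innerBump (r ^ 2) :=
    innerBump.continuous.comp (continuous_pow 2)
  have hc1 : HasCompactSupport fun r : ℝ => innerBump (r ^ 2) :=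
    hasCompactSupport_comp_sq fun s hs => innerBump_eq_zero' hs
  have h := integral_polar (n := n) (f := fun x => innerBump (‖x‖ ^ 2)) (a₁ := fun _ => 1)
    (a₂ := fun _ => 0) (by fun_prop) (by fun_prop) hb1 hb1 hc1 hc1 (fun x hx => by simp)
  have hpos : 0 < ∫ x : Ambient n, innerBump (‖x‖ ^ 2) := by
    refine Continuous.integral_pos_of_hasCompactSupport_nonneg_nonzero
      (x := EuclideanSpace.single 0 1) (innerBump.continuous.comp (by fun_prop)) ?_
      (fun x => innerBump.nonneg) ?_
    · have := cutoff_mul (n := n) innerBump.contDiff (fun s hs => innerBump_eq_zero' hs)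
        (g := fun _ => 1) (fun x _ => contDiffAt_const)
      simpa using this.2
    · have : innerBump (1 : ℝ) = 1 := innerBump.one_of_mem_closedBall (by simp [innerBump])
      simp [this]
  rw [h] at hpos
  simp only [integral_zero, zero_mul, add_zero] at hpos
  exact pos_of_mul_pos_right hpos (by positivity)

/-- The Laplace-Beltrami operator is symmetric when one of the two functions is a polynomial in
the pole coordinate. -/
theorem integral_polynomial_mul_laplaceBeltrami {φ : USphere n → ℝ}
    (hφ : ContMDiff (𝓡 n) 𝓘(ℝ, ℝ) ∞ φ) (P : Polynomial ℝ) (v : USphere n) :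
    ∫ q, P.eval (poleCoord v q) * laplaceBeltrami φ q ∂(sphereMeasure n)
      = ∫ q, (zonalOp n P).eval (poleCoord v q) * φ q ∂(sphereMeasure n) := by
  -- Testing with P = φ = 1 leaves only V_n times the radial error integral, which is therefore zero
  -- in every instance of the identity.
  have hone := green_identity_with_weights (n := n) (φ := fun q => (1 : Polynomial ℝ).eval (poleCoord v q))
    (contMDiff_polynomial_poleCoord 1 v) 1 v
  simp only [laplaceBeltrami_polynomial, eval_zonalOp] at hone
  have hB : (∫ r : Ioi (0 : ℝ), radialWeightLaplacian n ((r : ℝ) ^ 2) ∂.volumeIoiPow n) = 0 := by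
    simpa [measureReal_eq_zero_iff, sphereMeasure_ne_zero] using hone
  have h := green_identity_with_weights hφ P v
  rw [hB, mul_zero, sub_zero] at h
  exact mul_right_cancel₀ integral_innerBump_pos.ne' h

end SelfAdjoint

/-! ### The beta weight, incomplete beta functions and sphere volumes -/

section BetaWeight

open Filter Topology Set

variable {n : ℕ}

/-- The density `x ↦ (x (1 - x)) ^ (n / 2 - 1)` of the pole coordinate, up to a constant. -/
noncomputable def betaWeight (n : ℕ) (x : ℝ) : ℝ :=
  x ^ ((n : ℝ) / 2 - 1) * (1 - x) ^ ((n : ℝ) / 2 - 1)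

/-- The function `x ↦ (x (1 - x)) ^ (n / 2)`. -/
noncomputable def betaFlux (n : ℕ) (x : ℝ) : ℝ := x ^ ((n : ℝ) / 2) * (1 - x) ^ ((n : ℝ) / 2)

theorem betaWeight_one_sub (x : ℝ) : betaWeight n (1 - x) = betaWeight n x := by
  simp [betaWeight, mul_comm]

theorem betaFlux_one_sub (x : ℝ) : betaFlux n (1 - x) = betaFlux n x := by
  simp [betaFlux, mul_comm]

theorem betaWeight_nonneg {x : ℝ} (hx : x ∈ Icc (0 : ℝ) 1) : 0 ≤ betaWeight n x :=
  mul_nonneg (Real.rpow_nonneg hx.1 _) (Real.rpow_nonneg (by linarith [hx.2]) _)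

theorem betaWeight_pos {x : ℝ} (hx : x ∈ Ioo (0 : ℝ) 1) : 0 < betaWeight n x :=
  mul_pos (Real.rpow_pos_of_pos hx.1 _) (Real.rpow_pos_of_pos (by linarith [hx.2]) _)

theorem betaFlux_pos {x : ℝ} (hx : x ∈ Ioo (0 : ℝ) 1) : 0 < betaFlux n x :=
  mul_pos (Real.rpow_pos_of_pos hx.1 _) (Real.rpow_pos_of_pos (by linarith [hx.2]) _)

theorem betaFlux_eq {x : ℝ} (hx : x ∈ Ioo (0 : ℝ) 1) :
    betaFlux n x = x * (1 - x) * betaWeight n x := by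
  rw [betaFlux, betaWeight, Real.rpow_sub_one hx.1.ne', Real.rpow_sub_one (by linarith [hx.2])]
  have := hx.1.ne'
  have : 1 - x ≠ 0 := by linarith [hx.2]
  field_simp

theorem continuous_betaFlux : Continuous (betaFlux n) := by
  have h : (0 : ℝ) ≤ (n : ℝ) / 2 := by positivity
  exact (continuous_id.rpow_const fun _ => Or.inr h).mul
    ((continuous_const.sub continuous_id).rpow_const fun _ => Or.inr h)

theorem betaFlux_zero (hn : 1 ≤ n) : betaFlux n 0 = 0 := by
  have : (n : ℝ) / 2 ≠ 0 := by positivity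
  simp [betaFlux, Real.zero_rpow this]

theorem betaFlux_one (hn : 1 ≤ n) : betaFlux n 1 = 0 := by
  have : (n : ℝ) / 2 ≠ 0 := by positivity
  simp [betaFlux, Real.zero_rpow this]

@[fun_prop]
theorem measurable_betaWeight : Measurable (betaWeight n) := by
  unfold betaWeight; fun_prop

theorem continuousAt_betaWeight {x : ℝ} (hx : x ∈ Ioo (0 : ℝ) 1) :
    ContinuousAt (betaWeight n) x :=
  (continuousAt_id.rpow_const (Or.inl hx.1.ne')).mul
    ((continuousAt_const.sub continuousAt_id).rpow_const (Or.inl (by simpa using (by linarith [hx.2] : 1 - x ≠ 0))))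

theorem hasDerivAt_betaFlux {x : ℝ} (hx : x ∈ Ioo (0 : ℝ) 1) :
    HasDerivAt (betaFlux n) ((n : ℝ) / 2 * (1 - 2 * x) * betaWeight n x) x := by
  have h0 := hx.1.ne'
  have h1 : 1 - x ≠ 0 := by linarith [hx.2]
  have h := (Real.hasDerivAt_rpow_const (p := (n : ℝ) / 2) (Or.inl h0)).mul
    (((hasDerivAt_id x).const_sub 1).rpow_const (p := (n : ℝ) / 2) (Or.inl h1))
  refine h.congr_deriv ?_
  simp only [id, betaWeight, Real.rpow_sub_one h0, Real.rpow_sub_one h1]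
  field_simp
  ring

/-- Carries convergence and value of the complex beta integral over to the real integrand. -/
theorem rpow_mul_rpow_ofReal {α β x : ℝ} (hx : x ∈ Icc (0 : ℝ) 1) :
    ((x : ℂ) ^ ((α : ℂ) - 1) * (1 - (x : ℂ)) ^ ((β : ℂ) - 1)).re
      = x ^ (α - 1) * (1 - x) ^ (β - 1) := by
  have h1 : 0 ≤ 1 - x := by linarith [hx.2]
  rw [← Complex.ofReal_one, ← Complex.ofReal_sub, ← Complex.ofReal_sub, ← Complex.ofReal_sub,
    ← Complex.ofReal_cpow hx.1, ← Complex.ofReal_cpow h1, ← Complex.ofReal_mul,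
    Complex.ofReal_re]

theorem intervalIntegrable_beta {α β : ℝ} (hα : 0 < α) (hβ : 0 < β) :
    IntervalIntegrable (fun x : ℝ => x ^ (α - 1) * (1 - x) ^ (β - 1)) volume 0 1 := by
  have h := Complex.betaIntegral_convergent (u := α) (v := β) (by simpa) (by simpa)
  rw [intervalIntegrable_iff_integrableOn_Icc_of_le zero_le_one] at h ⊢
  refine IntegrableOn.congr_fun h.re (fun x hx => ?_) measurableSet_Icc
  exact rpow_mul_rpow_ofReal hx

theorem incBeta_one_eq {α β : ℝ} (hα : 0 < α) (hβ : 0 < β) :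
    incBeta 1 α β = Real.Gamma α * Real.Gamma β / Real.Gamma (α + β) := by
  have h := Complex.betaIntegral_convergent (u := α) (v := β) (by simpa) (by simpa)
  change _ = ProbabilityTheory.beta α β
  rw [ProbabilityTheory.beta_eq_betaIntegralReal α β hα hβ, Complex.betaIntegral, incBeta,
    intervalIntegral.integral_of_le zero_le_one, intervalIntegral.integral_of_le zero_le_one]
  rw [intervalIntegrable_iff_integrableOn_Ioc_of_le zero_le_one] at h
  rw [← RCLike.re_to_complex, ← integral_re h]
  refine setIntegral_congr_fun measurableSet_Ioc fun x hx => ?_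
  exact (rpow_mul_rpow_ofReal (Ioc_subset_Icc_self hx)).symm

theorem intervalIntegrable_betaWeight (hn : 1 ≤ n) {a b : ℝ} (ha : a ∈ Icc (0 : ℝ) 1)
    (hb : b ∈ Icc (0 : ℝ) 1) : IntervalIntegrable (betaWeight n) volume a b := by
  have h : (0 : ℝ) < (n : ℝ) / 2 := by positivity
  refine (intervalIntegrable_beta h h).mono_set ?_
  rw [uIcc_of_le (zero_le_one' ℝ)]
  exact uIcc_subset_Icc ha hb

/-- The incomplete beta function `B_x(n/2, n/2)`. -/
noncomputable def capBeta (n : ℕ) (x : ℝ) : ℝ := incBeta x ((n : ℝ) / 2) ((n : ℝ) / 2)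

theorem capBeta_eq (x : ℝ) : capBeta n x = ∫ t in (0 : ℝ)..x, betaWeight n t := rfl

theorem capBeta_zero : capBeta n 0 = 0 := by simp [capBeta_eq]

theorem capBeta_sub (hn : 1 ≤ n) {a b : ℝ} (ha : a ∈ Icc (0 : ℝ) 1) (hb : b ∈ Icc (0 : ℝ) 1) :
    capBeta n b - capBeta n a = ∫ t in a..b, betaWeight n t :=
  intervalIntegral.integral_interval_sub_left
    (intervalIntegrable_betaWeight hn (by simp) hb) (intervalIntegrable_betaWeight hn (by simp) ha)

theorem capBeta_strictMonoOn (hn : 1 ≤ n) : StrictMonoOn (capBeta n) (Icc 0 1) := by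
  intro a ha b hb hab
  rw [← sub_pos, capBeta_sub hn ha hb]
  exact intervalIntegral.intervalIntegral_pos_of_pos_on (intervalIntegrable_betaWeight hn ha hb)
    (fun x hx => betaWeight_pos ⟨ha.1.trans_lt hx.1, hx.2.trans_le hb.2⟩) hab

theorem capBeta_pos (hn : 1 ≤ n) {x : ℝ} (h0 : 0 < x) (h1 : x ≤ 1) : 0 < capBeta n x := by
  have := capBeta_strictMonoOn hn (a := 0) (by simp) (b := x) ⟨h0.le, h1⟩ h0
  rwa [capBeta_zero] at this

theorem continuousOn_capBeta (hn : 1 ≤ n) : ContinuousOn (capBeta n) (Icc 0 1) := by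
  have := intervalIntegral.continuousOn_primitive_interval (μ := volume)
    (f := betaWeight n) (a := 0) (b := 1)
    ((intervalIntegrable_iff_integrableOn_Icc_of_le zero_le_one).1
      (intervalIntegrable_betaWeight hn (by simp) (by simp)) |>.mono_set (by simp))
  rwa [uIcc_of_le (zero_le_one' ℝ)] at this

theorem hasDerivAt_capBeta (hn : 1 ≤ n) {x : ℝ} (hx : x ∈ Ioo (0 : ℝ) 1) :
    HasDerivAt (capBeta n) (betaWeight n x) x :=
  intervalIntegral.integral_hasDerivAt_right
    (intervalIntegrable_betaWeight hn (by simp) ⟨hx.1.le, hx.2.le⟩)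
    (measurable_betaWeight.stronglyMeasurable.stronglyMeasurableAtFilter)
    (continuousAt_betaWeight hx)

theorem capBeta_one_sub (hn : 1 ≤ n) {x : ℝ} (hx : x ∈ Icc (0 : ℝ) 1) :
    capBeta n (1 - x) = capBeta n 1 - capBeta n x := by
  rw [capBeta_sub hn hx (by simp), capBeta_eq]
  have := intervalIntegral.integral_comp_sub_left (f := betaWeight n) (a := 0) (b := 1 - x) 1
  simp only [betaWeight_one_sub, sub_sub_cancel, sub_zero] at this
  exact this

theorem sphereVol_eq (n : ℕ) : sphereVol n
    = (n + 1) * (√Real.pi ^ (n + 1) / Real.Gamma ((n + 1) / 2 + 1)) := by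
  rw [sphereVol, sphereMeasure, Measure.toSphere_real_apply_univ, measureReal_def,
    EuclideanSpace.volume_ball]
  have : 0 ≤ √Real.pi ^ (n + 1) / Real.Gamma ((n + 1 : ℝ) / 2 + 1) :=
    div_nonneg (by positivity) (Real.Gamma_nonneg_of_nonneg (by positivity))
  simp [ENNReal.toReal_ofReal this]

/-- With both volumes and B(n/2, n/2) = Γ(n/2)²/Γ(n) written through Γ, this is the Legendre
duplication formula at n/2. It fixes the constant in the pushforward of the surface measure. -/
theorem sphereVol_eq_capBeta (hn : 1 ≤ n) :
    sphereVol n = 2 ^ (n - 1) * sphereVol (n - 1) * capBeta n 1 := by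
  obtain ⟨k, rfl⟩ : ∃ k, n = k + 1 := ⟨n - 1, by omega⟩
  have hk : (0 : ℝ) < ((k + 1 : ℕ) : ℝ) / 2 := by positivity
  rw [capBeta, incBeta_one_eq hk hk, sphereVol_eq, sphereVol_eq, Nat.add_sub_cancel]
  have hd := Real.Gamma_mul_Gamma_add_half (((k + 1 : ℕ) : ℝ) / 2)
  have hG := Real.Gamma_pos_of_pos hk
  have h1 : Real.Gamma ((((k + 1 : ℕ) : ℝ) + 1) / 2 + 1)
      = (((k + 1 : ℕ) : ℝ) + 1) / 2 * Real.Gamma (((k + 1 : ℕ) : ℝ) / 2 + 1 / 2) := by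
    rw [Real.Gamma_add_one (by positivity)]; ring_nf
  have h2 : Real.Gamma (((k : ℝ) + 1) / 2 + 1)
      = ((k : ℝ) + 1) / 2 * Real.Gamma (((k + 1 : ℕ) : ℝ) / 2) := by
    rw [Real.Gamma_add_one (by positivity)]; push_cast; rfl
  have h3 : (2 : ℝ) ^ (1 - 2 * (((k + 1 : ℕ) : ℝ) / 2)) * 2 ^ k = 1 := by
    rw [← Real.rpow_natCast, ← Real.rpow_add two_pos]
    have : 1 - 2 * (((k + 1 : ℕ) : ℝ) / 2) + (k : ℝ) = 0 := by push_cast; ring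
    rw [this, Real.rpow_zero]
  have h4 : ((k + 1 : ℕ) : ℝ) / 2 + ((k + 1 : ℕ) : ℝ) / 2 = 2 * (((k + 1 : ℕ) : ℝ) / 2) := by ring
  rw [h1, h2, h4]
  have hG2 := Real.Gamma_pos_of_pos (by positivity : (0 : ℝ) < ((k + 1 : ℕ) : ℝ) / 2 + 1 / 2)
  have hG3 := Real.Gamma_pos_of_pos (by positivity : (0 : ℝ) < 2 * (((k + 1 : ℕ) : ℝ) / 2))
  generalize Real.Gamma (2 * (((k + 1 : ℕ) : ℝ) / 2)) = C at *
  generalize Real.Gamma (((k + 1 : ℕ) : ℝ) / 2 + 1 / 2) = B at *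
  generalize Real.Gamma (((k + 1 : ℕ) : ℝ) / 2) = A at *
  generalize (2 : ℝ) ^ (1 - 2 * (((k + 1 : ℕ) : ℝ) / 2)) = D at *
  have : √Real.pi ≠ 0 := by positivity
  have hAB : A * B * 2 ^ k = C * √Real.pi := by
    rw [hd]; linear_combination C * √Real.pi * h3
  field_simp
  rw [pow_succ]
  linear_combination (-√Real.pi ^ (k + 1)) * hAB

end BetaWeight

/-! ### Distribution of the pole coordinate -/

section Pushforward

open Filter Topology Set

variable {n : ℕ}

theorem poleCoord_mem_Icc (v q : USphere n) : poleCoord v q ∈ Icc (0 : ℝ) 1 := by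
  have h := abs_le.1 (abs_real_inner_le_norm (v : Ambient n) (q : Ambient n))
  rw [v.norm_coe, q.norm_coe] at h
  constructor <;> rw [poleCoord] <;> linarith [h.1, h.2]

theorem tendsto_integral_comp {α : Type*} [MeasurableSpace α] {μ : Measure α} {k X : α → ℝ}
    (hk : Integrable k μ) (hX : Measurable X) (hX' : ∀ a, X a ∈ Icc (0 : ℝ) 1)
    {f : ℕ → ℝ → ℝ} {g : ℝ → ℝ} {M : ℝ} (hf : ∀ j, Measurable (f j))
    (hM : ∀ j, ∀ x ∈ Icc (0 : ℝ) 1, |f j x| ≤ M)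
    (hlim : ∀ x ∈ Icc (0 : ℝ) 1, Tendsto (fun j => f j x) atTop (𝓝 (g x))) :
    Tendsto (fun j => ∫ a, k a * f j (X a) ∂μ) atTop (𝓝 (∫ a, k a * g (X a) ∂μ)) := by
  refine tendsto_integral_of_dominated_convergence (fun a => |k a| * M)
    (fun j => hk.aestronglyMeasurable.mul ((hf j).comp hX).aestronglyMeasurable)
    (hk.abs.mul_const M) (fun j => Eventually.of_forall fun a => ?_)
    (Eventually.of_forall fun a => (hlim _ (hX' a)).const_mul _)
  rw [Real.norm_eq_abs, abs_mul]
  exact mul_le_mul_of_nonneg_left (hM j _ (hX' a)) (abs_nonneg _)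

theorem exists_polynomial_seq {f : ℝ → ℝ} (hf : ContinuousOn f (Icc 0 1)) :
    ∃ (P : ℕ → Polynomial ℝ) (M : ℝ), (∀ j, ∀ x ∈ Icc (0 : ℝ) 1, |(P j).eval x| ≤ M) ∧
      ∀ x ∈ Icc (0 : ℝ) 1, Tendsto (fun j => (P j).eval x) atTop (𝓝 (f x)) := by
  choose P hP using fun j : ℕ => exists_polynomial_near_of_continuousOn 0 1 f hf (1 / (j + 1))
    (by positivity)
  obtain ⟨C, hC⟩ := isCompact_Icc.exists_bound_of_continuousOn hf
  refine ⟨P, C + 1, fun j x hx => ?_, fun x hx => ?_⟩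
  · have h1 := hP j x hx
    have h2 := hC x hx
    have h3 : (1 : ℝ) / (j + 1) ≤ 1 := by
      rw [div_le_one (by positivity)]; linarith [(Nat.cast_nonneg j : (0 : ℝ) ≤ j)]
    rw [Real.norm_eq_abs] at h2
    have := abs_sub_abs_le_abs_sub ((P j).eval x) (f x)
    linarith
  · rw [tendsto_iff_norm_sub_tendsto_zero]
    exact squeeze_zero (fun j => norm_nonneg _) (fun j => (hP j x hx).le)
      tendsto_one_div_add_atTop_nhds_zero_nat

theorem isLinearMap_integral_polynomial {α : Type*} [MeasurableSpace α] {μ : Measure α}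
    {k X : α → ℝ} (hk : Integrable k μ) (hX : Measurable X) (hX' : ∀ a, X a ∈ Icc (0 : ℝ) 1) :
    IsLinearMap ℝ fun P : Polynomial ℝ => ∫ a, k a * P.eval (X a) ∂μ := by
  have hi : ∀ P : Polynomial ℝ, Integrable (fun a => k a * P.eval (X a)) μ := fun P => by
    obtain ⟨C, hC⟩ := isCompact_Icc.exists_bound_of_continuousOn
      (P.continuous.continuousOn (s := Icc (0 : ℝ) 1))
    exact hk.mul_bdd (P.continuous.measurable.comp hX).aestronglyMeasurable
      (Eventually.of_forall fun a => hC _ (hX' a))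
  constructor
  · intro P Q
    simp only [Polynomial.eval_add, mul_add]
    exact integral_add (hi P) (hi Q)
  · intro c P
    simp only [Polynomial.eval_smul, smul_eq_mul, mul_left_comm, integral_const_mul]

/-- A linear functional on polynomials that vanishes on `1` and on the range of `zonalOp`
vanishes. -/
theorem eq_zero_of_zonalOp_eq_zero (hn : 1 ≤ n) {T : Polynomial ℝ → ℝ} (hT : IsLinearMap ℝ T)
    (h1 : T 1 = 0) (hz : ∀ P, T (zonalOp n P) = 0) (P : Polynomial ℝ) : T P = 0 := by
  have hX : ∀ k : ℕ, T (Polynomial.X ^ k) = 0 := by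
    intro k
    induction k with
    | zero => simpa using h1
    | succ k ih =>
      -- In the monomial basis the operator is triangular, and its diagonal entry (k+1)(k+n) is
      -- nonzero, so each power is reduced to the one below it.
      have hk : zonalOp n (Polynomial.X ^ (k + 1))
          = ((k + 1 : ℝ) * (k + n)) • Polynomial.X ^ (k + 1)
            - ((k + 1 : ℝ) * (k + n / 2)) • Polynomial.X ^ k := by
        refine Polynomial.funext fun x => ?_
        rw [eval_zonalOp]
        rcases k with _ | k
        · simp; ring
        · simp; ring
      have h := hz (Polynomial.X ^ (k + 1))
      rw [hk, hT.map_sub, hT.map_smul, hT.map_smul, ih, smul_zero, sub_zero, smul_eq_mul] at h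
      have : ((k + 1 : ℝ) * (k + n)) ≠ 0 := by positivity
      exact (mul_eq_zero.1 h).resolve_left this
  have : IsLinearMap.mk' T hT = 0 := Polynomial.lhom_ext' fun k => by
    ext
    simp only [LinearMap.comp_apply, IsLinearMap.mk'_apply, LinearMap.zero_apply]
    rw [Polynomial.monomial_one_right_eq_X_pow, hX]
  exact LinearMap.congr_fun this P

/-- In divergence form the integrand is -(`betaFlux` · P')', and the flux vanishes at both
endpoints. -/
theorem integral_betaWeight_zonalOp (hn : 1 ≤ n) (P : Polynomial ℝ) :
    ∫ x in (0 : ℝ)..1, betaWeight n x * (zonalOp n P).eval x = 0 := by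
  have h : ∀ x ∈ Ioo (0 : ℝ) 1, HasDerivAt (fun x => -(betaFlux n x * P.derivative.eval x))
      (betaWeight n x * (zonalOp n P).eval x) x := fun x hx => by
    refine ((hasDerivAt_betaFlux hx).mul (P.derivative.hasDerivAt x)).neg.congr_deriv ?_
    rw [betaFlux_eq hx, eval_zonalOp]
    ring
  rw [intervalIntegral.integral_eq_sub_of_hasDerivAt_of_le zero_le_one
    (continuous_betaFlux.mul P.derivative.continuous).neg.continuousOn h
    ((intervalIntegrable_betaWeight hn (by simp) (by simp)).mul_continuousOn
      (zonalOp n P).continuous.continuousOn)]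
  simp [betaFlux_zero hn, betaFlux_one hn]

theorem integral_zonalOp_poleCoord (P : Polynomial ℝ) (v : USphere n) :
    ∫ q, (zonalOp n P).eval (poleCoord v q) ∂(sphereMeasure n) = 0 := by
  have h := integral_polynomial_mul_laplaceBeltrami (contMDiff_polynomial_poleCoord 1 v) P v
  simp only [laplaceBeltrami_polynomial, eval_zonalOp (1 : Polynomial ℝ)] at h
  simpa using h.symm

/-- The constant `2 ^ (n - 1) * vol (S^(n - 1))` relating the surface measure to `betaWeight`. -/
noncomputable def capConst (n : ℕ) : ℝ := 2 ^ (n - 1) * sphereVol (n - 1)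

theorem capConst_pos : 0 < capConst n := mul_pos (by positivity) sphereVol_pos

theorem sphereVol_eq_capConst (hn : 1 ≤ n) : sphereVol n = capConst n * capBeta n 1 :=
  sphereVol_eq_capBeta hn

/-- Both sides are linear in `P`, vanish on the range of `zonalOp`, and agree at 1 by the volume
formula; these properties determine the functional. -/
theorem integral_polynomial_poleCoord (hn : 1 ≤ n) (P : Polynomial ℝ) (v : USphere n) :
    ∫ q, P.eval (poleCoord v q) ∂(sphereMeasure n)
      = capConst n * ∫ x in Ioc (0 : ℝ) 1, betaWeight n x * P.eval x := by
  have hw : IntegrableOn (betaWeight n) (Ioc 0 1) :=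
    (intervalIntegrable_iff_integrableOn_Ioc_of_le zero_le_one).1
      (intervalIntegrable_betaWeight hn (by simp) (by simp))
  -- The general lemmas want a coordinate with values in [0, 1] everywhere; clamping changes nothing
  -- on the domain of integration.
  let p : ℝ → ℝ := fun x => max 0 (min 1 x)
  have hp : ∀ x ∈ Ioc (0 : ℝ) 1, p x = x := fun x hx => by
    simp [p, min_eq_right hx.2, max_eq_right hx.1.le]
  have hL1 := isLinearMap_integral_polynomial (μ := sphereMeasure n) (k := fun _ => 1)
    (integrable_const _) (continuous_poleCoord v).measurable (poleCoord_mem_Icc v)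
  have hL2 := isLinearMap_integral_polynomial (k := betaWeight n) (X := p) hw
    (by fun_prop) (fun x => by simp [p])
  have hpe : ∀ P : Polynomial ℝ, ∫ x in Ioc (0 : ℝ) 1, betaWeight n x * P.eval (p x)
      = ∫ x in Ioc (0 : ℝ) 1, betaWeight n x * P.eval x := fun P =>
    setIntegral_congr_fun measurableSet_Ioc fun x hx => by simp only [hp x hx]
  simp only [hpe, one_mul] at hL1 hL2
  have h := eq_zero_of_zonalOp_eq_zero hn
    (T := fun P => ∫ q, P.eval (poleCoord v q) ∂(sphereMeasure n)
      - capConst n * ∫ x in Ioc (0 : ℝ) 1, betaWeight n x * P.eval x)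
    ⟨fun P Q => by simp only [hL1.map_add, hL2.map_add]; ring,
      fun c P => by simp only [hL1.map_smul, hL2.map_smul, smul_eq_mul]; ring⟩
    (by
      have := sphereVol_eq_capConst hn
      rw [capBeta_eq, intervalIntegral.integral_of_le zero_le_one, sphereVol] at this
      simp [this])
    (fun P => by
      have := integral_betaWeight_zonalOp hn P
      rw [intervalIntegral.integral_of_le zero_le_one] at this
      rw [integral_zonalOp_poleCoord, this]; simp) P
  linarith

/-- The measure on the line with density `betaWeight` on `(0, 1]`. -/
noncomputable def betaWeightMeasure (n : ℕ) : Measure ℝ :=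
  (volume.restrict (Ioc 0 1)).withDensity fun x => ENNReal.ofReal (betaWeight n x)

theorem integral_betaWeightMeasure (f : ℝ → ℝ) :
    ∫ x, f x ∂(betaWeightMeasure n) = ∫ x in Ioc (0 : ℝ) 1, betaWeight n x * f x := by
  rw [betaWeightMeasure, integral_withDensity_eq_integral_toReal_smul₀ (by fun_prop) (by simp)]
  refine setIntegral_congr_fun measurableSet_Ioc fun x hx => ?_
  simp [ENNReal.toReal_ofReal (betaWeight_nonneg (Ioc_subset_Icc_self hx))]

theorem integrable_betaWeightMeasure_iff (f : ℝ → ℝ) :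
    Integrable f (betaWeightMeasure n) ↔ IntegrableOn (fun x => betaWeight n x * f x) (Ioc 0 1) := by
  rw [betaWeightMeasure, integrable_withDensity_iff_integrable_smul' (by fun_prop) (by simp)]
  refine integrableOn_congr_fun (fun x hx => ?_) measurableSet_Ioc
  simp [ENNReal.toReal_ofReal (betaWeight_nonneg (Ioc_subset_Icc_self hx))]

/-- The surface measure pushes forward under `poleCoord v` to a multiple of `betaWeight`. -/
theorem map_poleCoord (hn : 1 ≤ n) (v : USphere n) :
    (sphereMeasure n).map (poleCoord v) = ENNReal.ofReal (capConst n) • betaWeightMeasure n := by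
  have hX := (continuous_poleCoord v).measurable
  have hw : IntegrableOn (betaWeight n) (Ioc 0 1) :=
    (intervalIntegrable_iff_integrableOn_Ioc_of_le zero_le_one).1
      (intervalIntegrable_betaWeight hn (by simp) (by simp))
  have : IsFiniteMeasure (betaWeightMeasure n) := by
    rw [← integrable_const_iff_isFiniteMeasure (one_ne_zero (α := ℝ)),
      integrable_betaWeightMeasure_iff]
    simpa using hw
  have : IsFiniteMeasure (ENNReal.ofReal (capConst n) • betaWeightMeasure n) :=
    Measure.smul_finite _ (by simp)
  refine ext_of_forall_integral_eq_of_IsFiniteMeasure fun f => ?_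
  rw [integral_map hX.aemeasurable f.continuous.aestronglyMeasurable, integral_smul_measure,
    integral_betaWeightMeasure, ENNReal.toReal_ofReal capConst_pos.le, smul_eq_mul]
  obtain ⟨P, M, hM, hlim⟩ := exists_polynomial_seq (f.continuous.continuousOn (s := Icc 0 1))
  have h1 := tendsto_integral_comp (μ := sphereMeasure n) (k := fun _ => 1) (integrable_const _)
    hX (poleCoord_mem_Icc v) (fun j => (P j).continuous.measurable) hM hlim
  simp only [one_mul, integral_polynomial_poleCoord hn] at h1
  let p : ℝ → ℝ := fun x => max 0 (min 1 x)
  have hp : ∀ x ∈ Ioc (0 : ℝ) 1, p x = x := fun x hx => by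
    simp [p, min_eq_right hx.2, max_eq_right hx.1.le]
  have h2 := tendsto_integral_comp (k := betaWeight n) (X := p) hw
    (by fun_prop) (fun x => by simp [p]) (fun j => (P j).continuous.measurable) hM hlim
  have hpe : ∀ f : ℝ → ℝ, ∫ x in Ioc (0 : ℝ) 1, betaWeight n x * f (p x)
      = ∫ x in Ioc (0 : ℝ) 1, betaWeight n x * f x := fun f =>
    setIntegral_congr_fun measurableSet_Ioc fun x hx => by simp only [hp x hx]
  rw [hpe f] at h2
  simp only [fun j => hpe (fun x => (P j).eval x)] at h2
  exact tendsto_nhds_unique h1 (h2.const_mul _)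

theorem integral_comp_poleCoord (hn : 1 ≤ n) (v : USphere n) {f : ℝ → ℝ} (hf : Measurable f) :
    ∫ q, f (poleCoord v q) ∂(sphereMeasure n)
      = capConst n * ∫ x in (0 : ℝ)..1, betaWeight n x * f x := by
  rw [← integral_map (continuous_poleCoord v).measurable.aemeasurable hf.aestronglyMeasurable,
    map_poleCoord hn, integral_smul_measure, integral_betaWeightMeasure,
    ENNReal.toReal_ofReal capConst_pos.le, smul_eq_mul,
    intervalIntegral.integral_of_le zero_le_one]

theorem integrable_comp_poleCoord (hn : 1 ≤ n) (v : USphere n) {f : ℝ → ℝ} (hf : Measurable f)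
    (h : IntervalIntegrable (fun x => betaWeight n x * f x) volume 0 1) :
    Integrable (fun q => f (poleCoord v q)) (sphereMeasure n) := by
  refine (integrable_map_measure (f := poleCoord v) (g := f) hf.aestronglyMeasurable
    (continuous_poleCoord v).measurable.aemeasurable).1 ?_
  rw [map_poleCoord hn]
  refine Integrable.smul_measure ?_ (by simp)
  rw [integrable_betaWeightMeasure_iff]
  exact (intervalIntegrable_iff_integrableOn_Ioc_of_le zero_le_one).1 h

end Pushforward

/-! ### Power series on the unit interval -/

section UnitPowerSeries

open Filter Topology Set

/-- The real power series with coefficients `a` converges absolutely on `(-1, 1)`. -/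
def ConvergesOnUnit (a : ℕ → ℝ) : Prop := ∀ r : ℝ, 0 ≤ r → r < 1 → Summable fun k => |a k| * r ^ k

/-- The sum of the power series with coefficients `a`. -/
noncomputable def powerSum (a : ℕ → ℝ) (y : ℝ) : ℝ := ∑' k, a k * y ^ k

/-- The coefficients of the derivative of a power series. -/
def derivCoeff (a : ℕ → ℝ) (k : ℕ) : ℝ := (k + 1) * a (k + 1)

theorem ConvergesOnUnit.hasSum {a : ℕ → ℝ} (ha : ConvergesOnUnit a) {y : ℝ} (hy : |y| < 1) :
    HasSum (fun k => a k * y ^ k) (powerSum a y) := by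
  refine Summable.hasSum ((ha |y| (abs_nonneg y) hy).of_norm_bounded fun k => ?_)
  rw [Real.norm_eq_abs, abs_mul, abs_pow]

/-- For r < s < 1 the factor (k+1)(r/s)^k is bounded, so convergence at s dominates the
differentiated series at r. -/
theorem ConvergesOnUnit.derivCoeff {a : ℕ → ℝ} (ha : ConvergesOnUnit a) :
    ConvergesOnUnit (derivCoeff a) := by
  intro r hr0 hr1
  obtain ⟨s, hrs, hs1⟩ := exists_between hr1
  have hs0 : 0 < s := hr0.trans_lt hrs
  have hq := (tendsto_self_mul_const_pow_of_lt_one (div_nonneg hr0 hs0.le)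
    ((div_lt_one hs0).2 hrs)).add (tendsto_pow_atTop_nhds_zero_of_lt_one (div_nonneg hr0 hs0.le)
    ((div_lt_one hs0).2 hrs))
  obtain ⟨C, hC⟩ := hq.bddAbove_range
  have hsum := ((summable_nat_add_iff 1).2 (ha s hs0.le hs1)).mul_left (C / s)
  refine hsum.of_norm_bounded fun k => ?_
  have h1 := hC ⟨k, rfl⟩
  have e : ‖|_root_.derivCoeff a k| * r ^ k‖ = |a (k + 1)| * s ^ (k + 1) / s *
      (k * (r / s) ^ k + (r / s) ^ k) := by
    rw [_root_.derivCoeff, Real.norm_eq_abs, abs_mul, abs_abs, abs_mul, abs_pow, abs_of_nonneg hr0,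
      abs_of_nonneg (by positivity : (0 : ℝ) ≤ k + 1), div_pow, pow_succ]
    field_simp
  rw [e]
  calc _ ≤ |a (k + 1)| * s ^ (k + 1) / s * C := mul_le_mul_of_nonneg_left h1 (by positivity)
    _ = _ := by ring

theorem ConvergesOnUnit.hasDerivAt {a : ℕ → ℝ} (ha : ConvergesOnUnit a) {y : ℝ} (hy : |y| < 1) :
    HasDerivAt (powerSum a) (powerSum (_root_.derivCoeff a) y) y := by
  obtain ⟨r, hyr, hr1⟩ := exists_between hy
  have hr0 : 0 ≤ r := (abs_nonneg y).trans hyr.le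
  have hu : Summable fun k : ℕ => k * |a k| * r ^ (k - 1) := by
    refine (summable_nat_add_iff 1).1 ?_
    refine (ha.derivCoeff r hr0 hr1).congr fun k => ?_
    rw [_root_.derivCoeff, abs_mul, abs_of_nonneg (by positivity : (0 : ℝ) ≤ k + 1)]
    simp
  have h := hasDerivAt_tsum_of_isPreconnected (g := fun k z => a k * z ^ k)
    (g' := fun k z => a k * (k * z ^ (k - 1))) (t := Ioo (-r) r) (y₀ := y) (y := y) hu isOpen_Ioo
    isPreconnected_Ioo (fun k z _ => (hasDerivAt_pow k z).const_mul (a k))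
    (fun k z hz => by
      rw [Real.norm_eq_abs, abs_mul, abs_mul, abs_pow, Nat.abs_cast]
      calc |a k| * (k * |z| ^ (k - 1)) = k * |a k| * |z| ^ (k - 1) := by ring
        _ ≤ k * |a k| * r ^ (k - 1) := by
          gcongr
          exact (abs_lt.2 hz).le)
    (abs_lt.1 hyr) (ha.hasSum hy).summable (abs_lt.1 hyr)
  refine h.congr_deriv ?_
  have hs : Summable fun k : ℕ => a k * (k * y ^ (k - 1)) := by
    refine hu.of_norm_bounded fun k => ?_
    rw [Real.norm_eq_abs, abs_mul, abs_mul, abs_pow, Nat.abs_cast]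
    calc |a k| * (k * |y| ^ (k - 1)) = k * |a k| * |y| ^ (k - 1) := by ring
      _ ≤ k * |a k| * r ^ (k - 1) := by gcongr
  rw [hs.tsum_eq_zero_add]
  simp only [powerSum, _root_.derivCoeff]
  simp
  exact tsum_congr fun k => by ring

theorem ConvergesOnUnit.continuousOn {a : ℕ → ℝ} (ha : ConvergesOnUnit a) :
    ContinuousOn (powerSum a) (Ioo (-1) 1) := fun _ hy =>
  (ha.hasDerivAt (abs_lt.2 hy)).continuousAt.continuousWithinAt

end UnitPowerSeries

/-! ### The hypergeometric series behind the Green function -/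

section GreenSeries

open Filter Topology Set

variable {n : ℕ}

/-- The coefficients of `(2 / n) ₂F₁(n, 1; n / 2 + 1; y)`. -/
noncomputable def greenCoeff (n k : ℕ) : ℝ :=
  2 / n * ((ascPochhammer ℝ k).eval (n : ℝ) / (ascPochhammer ℝ k).eval ((n : ℝ) / 2 + 1))

theorem greenCoeff_pos (hn : 1 ≤ n) (k : ℕ) : 0 < greenCoeff n k := by
  have h1 := ascPochhammer_pos k (n : ℝ) (by positivity)
  have h2 := ascPochhammer_pos k ((n : ℝ) / 2 + 1) (by positivity)
  have : (0 : ℝ) < n := by positivity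
  unfold greenCoeff
  positivity

theorem greenCoeff_zero : greenCoeff n 0 = 2 / n := by simp [greenCoeff]

theorem greenCoeff_succ (k : ℕ) :
    ((n : ℝ) / 2 + 1 + k) * greenCoeff n (k + 1) = (n + k) * greenCoeff n k := by
  have h2 := (ascPochhammer_pos k ((n : ℝ) / 2 + 1) (by positivity)).ne'
  have h3 : (n : ℝ) / 2 + 1 + k ≠ 0 := by positivity
  rw [greenCoeff, greenCoeff, ascPochhammer_succ_eval, ascPochhammer_succ_eval]
  field_simp

theorem convergesOnUnit_greenCoeff (hn : 1 ≤ n) : ConvergesOnUnit (greenCoeff n) := by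
  have key : ∀ s : ℝ, 0 < s → s < 1 → Summable fun k => greenCoeff n k * s ^ k := by
    intro s hs0 hs1
    refine summable_of_ratio_test_tendsto_lt_one hs1
      (Eventually.of_forall fun k => (mul_pos (greenCoeff_pos hn k) (pow_pos hs0 k)).ne') ?_
    have e : ∀ k : ℕ, ‖greenCoeff n (k + 1) * s ^ (k + 1)‖ / ‖greenCoeff n k * s ^ k‖
        = s * (1 + ((n : ℝ) / 2 - 1) / (((n : ℝ) / 2 + 1) + k)) := fun k => by
      have h1 := greenCoeff_pos hn k
      have h2 := greenCoeff_pos hn (k + 1)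
      have h3 : (n : ℝ) / 2 + 1 + k ≠ 0 := by positivity
      rw [Real.norm_of_nonneg (by positivity), Real.norm_of_nonneg (by positivity),
        div_eq_iff (by positivity), pow_succ]
      have := greenCoeff_succ (n := n) k
      field_simp
      field_simp at this
      linear_combination this
    simp only [e]
    have h : Tendsto (fun k : ℕ => ((n : ℝ) / 2 - 1) / (((n : ℝ) / 2 + 1) + k)) atTop (𝓝 0) :=
      tendsto_const_nhds.div_atTop
        (tendsto_atTop_add_const_left _ _ tendsto_natCast_atTop_atTop)
    simpa using (h.const_add 1).const_mul s
  intro r hr0 hr1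
  obtain ⟨s, hrs, hs1⟩ := exists_between hr1
  refine (key s (hr0.trans_lt hrs) hs1).of_norm_bounded fun k => ?_
  rw [abs_of_pos (greenCoeff_pos hn k),
    Real.norm_of_nonneg (mul_nonneg (greenCoeff_pos hn k).le (pow_nonneg hr0 k))]
  exact mul_le_mul_of_nonneg_left (pow_le_pow_left₀ hr0 hrs.le k) (greenCoeff_pos hn k).le

/-- The function `(2 / n) ₂F₁(n, 1; n / 2 + 1; y)`. -/
noncomputable def greenDeriv (n : ℕ) (y : ℝ) : ℝ := powerSum (greenCoeff n) y

/-- The derivative of `greenDeriv`. -/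
noncomputable def greenDeriv' (n : ℕ) (y : ℝ) : ℝ := powerSum (derivCoeff (greenCoeff n)) y

theorem hasDerivAt_greenDeriv (hn : 1 ≤ n) {y : ℝ} (hy : |y| < 1) :
    HasDerivAt (greenDeriv n) (greenDeriv' n y) y := (convergesOnUnit_greenCoeff hn).hasDerivAt hy

/-- The coefficient recursion `greenCoeff_succ` is this equation read termwise; the right-hand side
1 is the constant term (n/2)(2/n). Equivalently, `zonalOp` formally sends a primitive of
`greenDeriv` to -1. -/
theorem greenDeriv_ode (hn : 1 ≤ n) {y : ℝ} (hy : |y| < 1) :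
    y * (1 - y) * greenDeriv' n y + (n : ℝ) / 2 * (1 - 2 * y) * greenDeriv n y = 1 := by
  have hc := convergesOnUnit_greenCoeff hn
  have s1 : HasSum (fun k => greenCoeff n k * y ^ k) (greenDeriv n y) := hc.hasSum hy
  have s2 : HasSum (fun k => derivCoeff (greenCoeff n) k * y ^ k) (greenDeriv' n y) :=
    hc.derivCoeff.hasSum hy
  have s3 : HasSum (fun k : ℕ => k * greenCoeff n k * y ^ k) (y * greenDeriv' n y) := by
    refine (hasSum_nat_add_iff' 1).1 ?_
    simp only [Finset.sum_range_one, Nat.cast_zero, zero_mul, sub_zero]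
    refine (s2.mul_left y).congr_fun fun k => ?_
    simp only [derivCoeff]
    push_cast
    ring
  have s4 : HasSum (fun k : ℕ => ((n : ℝ) / 2 + 1 + k) * greenCoeff n (k + 1) * y ^ (k + 1))
      ((n : ℝ) / 2 * greenDeriv n y + y * greenDeriv' n y - 1) := by
    have h := (hasSum_nat_add_iff' 1).2 ((s1.mul_left ((n : ℝ) / 2)).add s3)
    have h0 : ∑ i ∈ Finset.range 1, ((n : ℝ) / 2 * (greenCoeff n i * y ^ i)
        + (i : ℝ) * greenCoeff n i * y ^ i) = 1 := by
      have : (n : ℝ) ≠ 0 := by positivity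
      simp only [Finset.sum_range_one, greenCoeff_zero]
      simp
      field_simp
    rw [h0] at h
    refine h.congr_fun fun k => ?_
    push_cast
    ring
  have s5 : HasSum (fun k : ℕ => ((n : ℝ) / 2 + 1 + k) * greenCoeff n (k + 1) * y ^ (k + 1))
      (y * (n * greenDeriv n y + y * greenDeriv' n y)) := by
    refine (((s1.mul_left (n : ℝ)).add s3).mul_left y).congr_fun fun k => ?_
    rw [greenCoeff_succ, pow_succ]
    ring
  linear_combination s4.unique s5

/-- Multiplied by `betaWeight`, the equation for `greenDeriv` reads (`betaFlux` · `greenDeriv`)' =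
`betaWeight`, and the flux vanishes at 0. -/
theorem capBeta_eq_betaFlux_mul (hn : 1 ≤ n) {y : ℝ} (hy : y ∈ Ico (0 : ℝ) 1) :
    capBeta n y = betaFlux n y * greenDeriv n y := by
  have hc : ContinuousOn (fun x => betaFlux n x * greenDeriv n x) (Icc 0 y) := by
    refine continuous_betaFlux.continuousOn.mul
      ((convergesOnUnit_greenCoeff hn).continuousOn.mono fun x hx => ⟨?_, ?_⟩)
    · linarith [hx.1]
    · linarith [hx.2, hy.2]
  have h := intervalIntegral.integral_eq_sub_of_hasDerivAt_of_le hy.1 hc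
    (f' := betaWeight n) (fun x hx => by
      have hx' : x ∈ Ioo (0 : ℝ) 1 := ⟨hx.1, hx.2.trans hy.2⟩
      have hx1 : |x| < 1 := by rw [abs_of_pos hx'.1]; exact hx'.2
      refine ((hasDerivAt_betaFlux hx').mul (hasDerivAt_greenDeriv hn hx1)).congr_deriv ?_
      rw [betaFlux_eq hx']
      linear_combination betaWeight n x * greenDeriv_ode hn hx1)
    (intervalIntegrable_betaWeight hn (by simp) ⟨hy.1, hy.2.le⟩)
  rw [betaFlux_zero hn] at h
  rw [capBeta_eq, h]
  simp

/-- The coefficients of the primitive of `greenDeriv`. -/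
noncomputable def greenPrimCoeff (n : ℕ) : ℕ → ℝ
  | 0 => 0
  | k + 1 => greenCoeff n k / (k + 1)

open Classical in
/-- The primitive of `greenDeriv` on `(-1, 1)` that vanishes at `0`. -/
noncomputable def greenPrim (n : ℕ) : ℝ → ℝ :=
  (Ioo (-1) 1 : Set ℝ).piecewise (powerSum (greenPrimCoeff n)) fun _ => 0

theorem convergesOnUnit_greenPrimCoeff (hn : 1 ≤ n) : ConvergesOnUnit (greenPrimCoeff n) := by
  intro r hr0 hr1
  refine (summable_nat_add_iff 1).1 ?_
  refine (convergesOnUnit_greenCoeff hn r hr0 hr1).of_norm_bounded fun k => ?_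
  have h := greenCoeff_pos hn k
  have h1 : greenCoeff n k / (k + 1) ≤ greenCoeff n k := div_le_self h.le (by simp)
  have h2 : r ^ (k + 1) ≤ r ^ k := pow_le_pow_of_le_one hr0 hr1.le (Nat.le_succ k)
  simp only [greenPrimCoeff]
  rw [Real.norm_of_nonneg (by positivity), abs_of_nonneg (by positivity), abs_of_pos h]
  gcongr

theorem derivCoeff_greenPrimCoeff : derivCoeff (greenPrimCoeff n) = greenCoeff n := by
  ext k
  have : (k : ℝ) + 1 ≠ 0 := by positivity
  simp only [derivCoeff, greenPrimCoeff]
  field_simp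

theorem greenPrim_eq {y : ℝ} (hy : y ∈ Ioo (-1 : ℝ) 1) :
    greenPrim n y = powerSum (greenPrimCoeff n) y := by simp [greenPrim, hy]

theorem hasDerivAt_greenPrim (hn : 1 ≤ n) {y : ℝ} (hy : |y| < 1) :
    HasDerivAt (greenPrim n) (greenDeriv n y) y := by
  have h := (convergesOnUnit_greenPrimCoeff hn).hasDerivAt hy
  rw [derivCoeff_greenPrimCoeff] at h
  refine h.congr_of_eventuallyEq ?_
  filter_upwards [isOpen_Ioo.mem_nhds (abs_lt.1 hy)] with z hz using greenPrim_eq hz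

theorem measurable_greenPrim (hn : 1 ≤ n) : Measurable (greenPrim n) := by
  classical
  unfold greenPrim
  convert ContinuousOn.measurable_piecewise (convergesOnUnit_greenPrimCoeff hn).continuousOn
    (continuousOn_const (c := (0 : ℝ))) measurableSet_Ioo

theorem greenPrim_hasSum (hn : 1 ≤ n) {y : ℝ} (hy : |y| < 1) :
    HasSum (fun k => greenCoeff n k / (k + 1) * y ^ (k + 1)) (greenPrim n y) := by
  rw [greenPrim_eq (abs_lt.1 hy)]
  have h := (hasSum_nat_add_iff' 1).2 ((convergesOnUnit_greenPrimCoeff hn).hasSum hy)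
  simpa [greenPrimCoeff] using h

theorem greenPrim_zero (hn : 1 ≤ n) : greenPrim n 0 = 0 :=
  (greenPrim_hasSum hn (by simp)).unique (by simp)

/-- The default value 0 makes this valid also at y = 1, the argument that occurs at the pole itself.
-/
theorem greenPrim_nonneg (hn : 1 ≤ n) {y : ℝ} (hy : 0 ≤ y) : 0 ≤ greenPrim n y := by
  by_cases h : y ∈ Ioo (-1 : ℝ) 1
  · refine (greenPrim_hasSum hn (abs_lt.2 h)).nonneg fun k => ?_
    have := greenCoeff_pos hn k
    positivity
  · simp [greenPrim, h]

theorem continuousOn_greenPrim (hn : 1 ≤ n) : ContinuousOn (greenPrim n) (Ioo (-1) 1) :=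
  fun _ hy => (hasDerivAt_greenPrim hn (abs_lt.2 hy)).continuousAt.continuousWithinAt

end GreenSeries

/-! ### Integrals over caps and the constant K -/

section CapIntegrals

open Filter Topology Set

variable {n : ℕ}

/-- The integral of `greenPrim` against `betaWeight` over `[0, x]`. -/
noncomputable def capInt (n : ℕ) (x : ℝ) : ℝ := ∫ t in (0 : ℝ)..x, betaWeight n t * greenPrim n t

theorem intervalIntegrable_betaWeight_mul (hn : 1 ≤ n) {a b : ℝ} (ha : a ∈ Ico (0 : ℝ) 1)
    (hb : b ∈ Ico (0 : ℝ) 1) :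
    IntervalIntegrable (fun t => betaWeight n t * greenPrim n t) volume a b := by
  refine (intervalIntegrable_betaWeight hn ⟨ha.1, ha.2.le⟩ ⟨hb.1, hb.2.le⟩).mul_continuousOn
    ((continuousOn_greenPrim hn).mono fun x hx => ?_)
  rcases le_total a b with h | h
  · rw [uIcc_of_le h] at hx
    exact ⟨by linarith [hx.1, ha.1], hx.2.trans_lt hb.2⟩
  · rw [uIcc_of_ge h] at hx
    exact ⟨by linarith [hx.1, hb.1], hx.2.trans_lt ha.2⟩

theorem hasDerivAt_capInt (hn : 1 ≤ n) {x : ℝ} (hx : x ∈ Ioo (0 : ℝ) 1) :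
    HasDerivAt (capInt n) (betaWeight n x * greenPrim n x) x := by
  have hx1 : |x| < 1 := by rw [abs_of_pos hx.1]; exact hx.2
  exact intervalIntegral.integral_hasDerivAt_right
    (intervalIntegrable_betaWeight_mul hn (by simp) ⟨hx.1.le, hx.2⟩)
    ((measurable_betaWeight.mul (measurable_greenPrim hn)).stronglyMeasurable.stronglyMeasurableAtFilter)
    ((continuousAt_betaWeight hx).mul (hasDerivAt_greenPrim hn hx1).continuousAt)

theorem capInt_nonneg (hn : 1 ≤ n) {x : ℝ} (hx : x ∈ Icc (0 : ℝ) 1) : 0 ≤ capInt n x :=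
  intervalIntegral.integral_nonneg hx.1 fun _ ht =>
    mul_nonneg (betaWeight_nonneg ⟨ht.1, ht.2.trans hx.2⟩) (greenPrim_nonneg hn ht.1)

theorem one_sub_mem_Ioo {x : ℝ} (hx : x ∈ Ioo (0 : ℝ) 1) : 1 - x ∈ Ioo (0 : ℝ) 1 :=
  ⟨by linarith [hx.2], by linarith [hx.1]⟩

theorem betaFlux_mul_greenDeriv (hn : 1 ≤ n) {x : ℝ} (hx : x ∈ Ioo (0 : ℝ) 1) :
    betaFlux n x * greenDeriv n (1 - x) = capBeta n (1 - x) := by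
  have h := one_sub_mem_Ioo hx
  rw [capBeta_eq_betaFlux_mul hn ⟨h.1.le, h.2⟩, betaFlux_one_sub]

/-- The symmetric combination of cap integrals that does not depend on the cap. -/
noncomputable def capInvariant (n : ℕ) (x : ℝ) : ℝ :=
  greenPrim n (1 - x) * capBeta n x + capBeta n (1 - x) * greenPrim n x
    + capInt n x + capInt n (1 - x)

/-- The terms with `betaWeight` cancel in pairs. The other two cancel because `capBeta` is
`betaFlux` times `greenDeriv` both at x and at 1 - x, and the flux is symmetric. -/
theorem hasDerivAt_capInvariant (hn : 1 ≤ n) {x : ℝ} (hx : x ∈ Ioo (0 : ℝ) 1) :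
    HasDerivAt (capInvariant n) 0 x := by
  have hy := one_sub_mem_Ioo hx
  have hx1 : |x| < 1 := by rw [abs_of_pos hx.1]; exact hx.2
  have hy1 : |1 - x| < 1 := by rw [abs_of_pos hy.1]; exact hy.2
  have hs : HasDerivAt (fun x : ℝ => 1 - x) (-1) x := (hasDerivAt_id x).const_sub 1
  have h := (((((hasDerivAt_greenPrim hn hy1).comp x hs).mul (hasDerivAt_capBeta hn hx)).add
    (((hasDerivAt_capBeta hn hy).comp x hs).mul (hasDerivAt_greenPrim hn hx1))).add
    (hasDerivAt_capInt hn hx)).add ((hasDerivAt_capInt hn hy).comp x hs)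
  refine h.congr_deriv ?_
  have e1 := betaFlux_mul_greenDeriv hn hx
  have e2 := capBeta_eq_betaFlux_mul hn ⟨hx.1.le, hx.2⟩
  simp only [Function.comp, betaWeight_one_sub, ← e1, e2]
  ring

theorem capInvariant_const (hn : 1 ≤ n) : ∃ D, ∀ x ∈ Ioo (0 : ℝ) 1, capInvariant n x = D :=
  isOpen_Ioo.exists_is_const_of_deriv_eq_zero isPreconnected_Ioo
    (fun _ hx => (hasDerivAt_capInvariant hn hx).differentiableAt.differentiableWithinAt)
    fun _ hx => (hasDerivAt_capInvariant hn hx).deriv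

/-- The other three terms of the invariant are nonnegative. As the invariant is constant, this
bounds the cap integrals uniformly up to the endpoint 1, hence gives integrability without
asymptotics of the series. -/
theorem capInt_le (hn : 1 ≤ n) {x : ℝ} (hx : x ∈ Ioo (0 : ℝ) 1) : capInt n x ≤ capInvariant n x := by
  have hy := one_sub_mem_Ioo hx
  have h1 := mul_nonneg (greenPrim_nonneg hn hy.1.le) (capBeta_pos hn hx.1 hx.2.le).le
  have h2 := mul_nonneg (capBeta_pos hn hy.1 hy.2.le).le (greenPrim_nonneg hn hx.1.le)
  have h3 := capInt_nonneg hn ⟨hy.1.le, hy.2.le⟩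
  rw [capInvariant]
  linarith

/-- `greenPrim` is integrable against `betaWeight` up to its singularity. -/
theorem intervalIntegrable_betaWeight_mul_greenPrim (hn : 1 ≤ n) :
    IntervalIntegrable (fun t => betaWeight n t * greenPrim n t) volume 0 1 := by
  obtain ⟨D, hD⟩ := capInvariant_const hn
  rw [intervalIntegrable_iff_integrableOn_Ioc_of_le zero_le_one]
  have hb : ∀ i : ℕ, (1 - 1 / ((i : ℝ) + 2)) ∈ Ioo (0 : ℝ) 1 := fun i => by
    have h : (0 : ℝ) ≤ i := Nat.cast_nonneg i
    refine one_sub_mem_Ioo ⟨by positivity, ?_⟩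
    rw [div_lt_one (by positivity)]; linarith
  refine integrableOn_Ioc_of_intervalIntegral_norm_bounded_right (l := atTop)
    (b := fun i : ℕ => 1 - 1 / ((i : ℝ) + 2)) (I := D) (fun i => ?_) ?_
    (Eventually.of_forall fun i => ?_)
  · exact (intervalIntegrable_iff_integrableOn_Ioc_of_le (hb i).1.le).1
      (intervalIntegrable_betaWeight_mul hn (by simp) ⟨(hb i).1.le, (hb i).2⟩)
  · have h : Tendsto (fun i : ℕ => (1 : ℝ) / ((i : ℝ) + 2)) atTop (𝓝 0) :=
      tendsto_const_nhds.div_atTop (tendsto_atTop_add_const_right _ _ tendsto_natCast_atTop_atTop)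
    simpa using h.const_sub 1
  · rw [← hD _ (hb i)]
    refine le_trans (le_of_eq ?_) (capInt_le hn (hb i))
    rw [capInt, intervalIntegral.integral_of_le (hb i).1.le]
    refine setIntegral_congr_fun measurableSet_Ioc fun t ht => ?_
    exact Real.norm_of_nonneg (mul_nonneg (betaWeight_nonneg ⟨ht.1.le, ht.2.trans (hb i).2.le⟩)
      (greenPrim_nonneg hn ht.1.le))

theorem continuousOn_capInt (hn : 1 ≤ n) : ContinuousOn (capInt n) (Icc 0 1) := by
  have := intervalIntegral.continuousOn_primitive_interval (μ := volume)
    (f := fun t => betaWeight n t * greenPrim n t) (a := 0) (b := 1)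
    ((intervalIntegrable_iff_integrableOn_Icc_of_le zero_le_one).1
      (intervalIntegrable_betaWeight_mul_greenPrim hn) |>.mono_set (by simp))
  rwa [uIcc_of_le (zero_le_one' ℝ)] at this

theorem greenPrim_monotoneOn (hn : 1 ≤ n) : MonotoneOn (greenPrim n) (Ico 0 1) := by
  intro x hx y hy hxy
  refine hasSum_le (fun k => ?_)
    (greenPrim_hasSum hn (y := x) (by rw [abs_of_nonneg hx.1]; exact hx.2))
    (greenPrim_hasSum hn (y := y) (by rw [abs_of_nonneg hy.1]; exact hy.2))
  have := greenCoeff_pos hn k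
  have := hx.1
  gcongr

/-- `capBeta n x` is the weight of [1-x, 1] by symmetry, and `greenPrim` is at least its value at 1
- x on [1-x, 1). This controls a possible ∞ · 0 as x → 0. -/
theorem greenPrim_mul_capBeta_le (hn : 1 ≤ n) {x : ℝ} (hx : x ∈ Ioo (0 : ℝ) 1) :
    greenPrim n (1 - x) * capBeta n x ≤ capInt n 1 - capInt n (1 - x) := by
  have hy := one_sub_mem_Ioo hx
  have hint := intervalIntegrable_betaWeight_mul_greenPrim hn
  have hsub : capInt n 1 - capInt n (1 - x) = ∫ t in (1 - x)..1, betaWeight n t * greenPrim n t :=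
    intervalIntegral.integral_interval_sub_left hint
      (intervalIntegrable_betaWeight_mul hn (by simp) ⟨hy.1.le, hy.2⟩)
  have hcap : capBeta n x = ∫ t in (1 - x)..1, betaWeight n t := by
    rw [← capBeta_sub hn ⟨hy.1.le, hy.2.le⟩ (by simp), capBeta_one_sub hn ⟨hx.1.le, hx.2.le⟩]
    ring
  rw [hsub, hcap, ← intervalIntegral.integral_const_mul]
  refine intervalIntegral.integral_mono_on_of_le_Ioo hy.2.le
    ((intervalIntegrable_betaWeight hn ⟨hy.1.le, hy.2.le⟩ (by simp)).const_mul _) ?_ fun t ht => ?_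
  · refine hint.mono_set ?_
    rw [uIcc_of_le hy.2.le, uIcc_of_le (zero_le_one' ℝ)]
    exact Icc_subset_Icc_left hy.1.le
  · have ht0 : 0 < t := hy.1.trans ht.1
    rw [mul_comm]
    exact mul_le_mul_of_nonneg_left (greenPrim_monotoneOn hn ⟨hy.1.le, hy.2⟩ ⟨ht0.le, ht.2⟩ ht.1.le)
      (betaWeight_nonneg ⟨ht0.le, ht.2.le⟩)

/-- The constant is identified by letting x → 0⁺: only the last term of the invariant survives. -/
theorem capInvariant_eq (hn : 1 ≤ n) {x : ℝ} (hx : x ∈ Ioo (0 : ℝ) 1) :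
    capInvariant n x = capInt n 1 := by
  obtain ⟨D, hD⟩ := capInvariant_const hn
  rw [hD x hx]
  have hne : (𝓝[>] (0 : ℝ)).NeBot := inferInstance
  have hmem : ∀ᶠ y in 𝓝[>] (0 : ℝ), y ∈ Ioo (0 : ℝ) 1 := Ioo_mem_nhdsGT one_pos
  have hsub : 𝓝[>] (0 : ℝ) ≤ 𝓝[Icc 0 1] 0 :=
    le_inf nhdsWithin_le_nhds (le_principal_iff.2 (hmem.mono fun y hy => ⟨hy.1.le, hy.2.le⟩))
  have hflip : Tendsto (fun y : ℝ => 1 - y) (𝓝[>] 0) (𝓝[Icc 0 1] 1) := by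
    refine tendsto_nhdsWithin_iff.2 ⟨?_, hmem.mono fun y hy => ?_⟩
    · have : Tendsto (fun y : ℝ => 1 - y) (𝓝 0) (𝓝 (1 - 0)) :=
        (continuous_const.sub continuous_id).tendsto 0
      rw [sub_zero] at this
      exact this.mono_left nhdsWithin_le_nhds
    · exact ⟨by linarith [hy.2], by linarith [hy.1]⟩
  have t1 : Tendsto (fun y => capInt n (1 - y)) (𝓝[>] 0) (𝓝 (capInt n 1)) :=
    ((continuousOn_capInt hn) 1 (by simp)).tendsto.comp hflip
  have t2 : Tendsto (capInt n) (𝓝[>] 0) (𝓝 0) := by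
    have h := ((continuousOn_capInt hn) 0 (by simp)).tendsto.mono_left hsub
    simpa [capInt] using h
  have t3 : Tendsto (fun y => capBeta n (1 - y)) (𝓝[>] 0) (𝓝 (capBeta n 1)) :=
    ((continuousOn_capBeta hn) 1 (by simp)).tendsto.comp hflip
  have t4 : Tendsto (greenPrim n) (𝓝[>] 0) (𝓝 0) := by
    have h := (hasDerivAt_greenPrim hn (y := 0) (by simp)).continuousAt.tendsto
    rw [greenPrim_zero hn] at h
    exact h.mono_left nhdsWithin_le_nhds
  have t5 : Tendsto (fun y => greenPrim n (1 - y) * capBeta n y) (𝓝[>] 0) (𝓝 0) := by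
    refine tendsto_of_tendsto_of_tendsto_of_le_of_le' tendsto_const_nhds
      (by simpa using t1.const_sub (capInt n 1))
      (hmem.mono fun y hy => ?_) (hmem.mono fun y hy => greenPrim_mul_capBeta_le hn hy)
    exact mul_nonneg (greenPrim_nonneg hn (one_sub_mem_Ioo hy).1.le)
      (capBeta_pos hn hy.1 hy.2.le).le
  have t : Tendsto (capInvariant n) (𝓝[>] 0) (𝓝 (0 + capBeta n 1 * 0 + 0 + capInt n 1)) :=
    ((t5.add (t3.mul t4)).add t2).add t1
  have t' : Tendsto (capInvariant n) (𝓝[>] 0) (𝓝 D) :=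
    tendsto_const_nhds.congr' (hmem.mono fun y hy => (hD y hy).symm)
  simpa using tendsto_nhds_unique t' t

/-- The series defining `greenConst` is the mean of `greenPrim` over the cap. -/
theorem greenConst_eq (hn : 1 ≤ n) {a : ℝ} (hx : Real.sin (a / 2) ^ 2 ∈ Ioo (0 : ℝ) 1) :
    greenConst n a = (sphereVol n)⁻¹ *
      (capInt n (Real.sin (a / 2) ^ 2) / capBeta n (Real.sin (a / 2) ^ 2)) := by
  set x := Real.sin (a / 2) ^ 2 with hxdef
  have hx1 : |x| < 1 := by rw [abs_of_pos hx.1]; exact hx.2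
  have hw := intervalIntegrable_betaWeight hn (a := 0) (b := x) (by simp) ⟨hx.1.le, hx.2.le⟩
  -- Termwise integration, dominated by the convergent series at the right endpoint x < 1.
  have hsum : HasSum (fun k : ℕ => ∫ t in (0 : ℝ)..x,
      betaWeight n t * (greenCoeff n k / (k + 1) * t ^ (k + 1))) (capInt n x) := by
    refine intervalIntegral.hasSum_integral_of_dominated_convergence
      (fun k t => betaWeight n t * (greenCoeff n k / (k + 1) * x ^ (k + 1)))
      (fun k => (measurable_betaWeight.mul (by fun_prop)).aestronglyMeasurable)
      (fun k => Eventually.of_forall fun t ht => ?_) (Eventually.of_forall fun t ht => ?_) ?_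
      (Eventually.of_forall fun t ht => ?_)
    · rw [uIoc_of_le hx.1.le] at ht
      have h1 := greenCoeff_pos hn k
      have h2 := betaWeight_nonneg (n := n) (x := t) ⟨ht.1.le, ht.2.trans hx.2.le⟩
      have h3 := ht.1.le
      have h4 := ht.2
      rw [Real.norm_of_nonneg (by positivity)]
      gcongr
    · exact (greenPrim_hasSum hn hx1).summable.mul_left _
    · simp only [tsum_mul_left]
      exact hw.mul_const _
    · rw [uIoc_of_le hx.1.le] at ht
      exact (greenPrim_hasSum hn
        (by rw [abs_of_pos ht.1]; exact ht.2.trans_lt hx.2)).mul_left _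
  have hterm : ∀ k : ℕ, ∫ t in (0 : ℝ)..x, betaWeight n t * (greenCoeff n k / (k + 1) * t ^ (k + 1))
      = greenCoeff n k / (k + 1) * incBeta x ((n : ℝ) / 2 + k + 1) ((n : ℝ) / 2) := fun k => by
    rw [incBeta, ← intervalIntegral.integral_const_mul]
    refine intervalIntegral.integral_congr_ae (Eventually.of_forall fun t ht => ?_)
    rw [uIoc_of_le hx.1.le] at ht
    have e : (n : ℝ) / 2 + k + 1 - 1 = ((n : ℝ) / 2 - 1) + ((k + 1 : ℕ) : ℝ) := by push_cast; ring
    rw [betaWeight, e, Real.rpow_add_natCast ht.1.ne']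
    ring
  simp only [hterm] at hsum
  have hI : capBeta n x ≠ 0 := (capBeta_pos hn hx.1 hx.2.le).ne'
  have h2 := ((hsum.div_const (capBeta n x)).mul_left (sphereVol n)⁻¹).tsum_eq
  rw [← h2, greenConst, ← tsum_mul_left]
  refine tsum_congr fun k => ?_
  rw [greenCoeff, capBeta, ← hxdef]
  have : (k : ℝ) + 1 ≠ 0 := by positivity
  have : (n : ℝ) ≠ 0 := by positivity
  have := sphereVol_pos (n := n).ne'
  have := (ascPochhammer_pos k ((n : ℝ) / 2 + 1) (by positivity)).ne'
  rw [capBeta] at hI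
  generalize incBeta x ((n : ℝ) / 2 + k + 1) ((n : ℝ) / 2) = b₁ at *
  generalize incBeta x ((n : ℝ) / 2) ((n : ℝ) / 2) = b₀ at *
  field_simp

end CapIntegrals

/-! ### Extending the zonal identity from polynomials to cap potentials -/

section ZonalIdentity

open Filter Topology Set

variable {n : ℕ}

/-- The primitive of `u` with value `c` at `0`. -/
noncomputable def primFrom (c : ℝ) (u : ℝ → ℝ) (x : ℝ) : ℝ := c + ∫ t in (0 : ℝ)..x, u t

theorem continuous_primFrom (c : ℝ) {u : ℝ → ℝ} (hu : Continuous u) : Continuous (primFrom c u) :=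
  continuous_const.add
    (intervalIntegral.continuous_primitive (fun a b => hu.intervalIntegrable a b) 0)

theorem abs_primFrom_le {c M : ℝ} {u : ℝ → ℝ} (hM : ∀ x ∈ Icc (0 : ℝ) 1, |u x| ≤ M) {x : ℝ}
    (hx : x ∈ Icc (0 : ℝ) 1) : |primFrom c u x| ≤ |c| + M := by
  have h0 : 0 ≤ M := (abs_nonneg _).trans (hM 0 (by simp))
  have h := intervalIntegral.norm_integral_le_of_norm_le_const (a := 0) (b := x) (f := u) (C := M)
    fun t ht => by
      rw [uIoc_of_le hx.1] at ht
      exact hM t ⟨ht.1.le, ht.2.trans hx.2⟩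
  rw [sub_zero, abs_of_nonneg hx.1, Real.norm_eq_abs] at h
  refine (abs_add_le _ _).trans (add_le_add le_rfl (h.trans ?_))
  exact mul_le_of_le_one_right h0 hx.2

theorem tendsto_primFrom {c M : ℝ} {u : ℕ → ℝ → ℝ} {v : ℝ → ℝ} (hu : ∀ j, Measurable (u j))
    (hM : ∀ j, ∀ x ∈ Icc (0 : ℝ) 1, |u j x| ≤ M)
    (hlim : ∀ x ∈ Icc (0 : ℝ) 1, Tendsto (fun j => u j x) atTop (𝓝 (v x))) {x : ℝ}
    (hx : x ∈ Icc (0 : ℝ) 1) :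
    Tendsto (fun j => primFrom c (u j) x) atTop (𝓝 (primFrom c v x)) := by
  have hsub : ∀ t ∈ uIoc 0 x, t ∈ Icc (0 : ℝ) 1 := fun t ht => by
    rw [uIoc_of_le hx.1] at ht
    exact ⟨ht.1.le, ht.2.trans hx.2⟩
  refine tendsto_const_nhds.add ?_
  exact intervalIntegral.tendsto_integral_filter_of_dominated_convergence (fun _ => M)
    (Eventually.of_forall fun j => (hu j).aestronglyMeasurable)
    (Eventually.of_forall fun j => Eventually.of_forall fun t ht => hM j t (hsub t ht))
    (by simp) (Eventually.of_forall fun t ht => hlim t (hsub t ht))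

theorem primFrom_congr {c : ℝ} {u v : ℝ → ℝ} (h : ∀ x ∈ Icc (0 : ℝ) 1, u x = v x) {x : ℝ}
    (hx : x ∈ Icc (0 : ℝ) 1) : primFrom c u x = primFrom c v x := by
  refine congrArg (c + ·) (intervalIntegral.integral_congr fun t ht => ?_)
  rw [uIcc_of_le hx.1] at ht
  exact h t ⟨ht.1, ht.2.trans hx.2⟩

theorem exists_polynomial_primFrom (P : Polynomial ℝ) (c : ℝ) : ∃ Q : Polynomial ℝ,
    Q.derivative = P ∧ ∀ x, Q.eval x = primFrom c (fun t => P.eval t) x := by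
  have h : ∃ Q : Polynomial ℝ, Q.derivative = P := by
    induction P using Polynomial.induction_on' with
    | add p q hp hq =>
      obtain ⟨p', hp⟩ := hp
      obtain ⟨q', hq⟩ := hq
      exact ⟨p' + q', by simp [hp, hq]⟩
    | monomial k a =>
      refine ⟨Polynomial.monomial (k + 1) (a / (k + 1)), ?_⟩
      have : (k : ℝ) + 1 ≠ 0 := by positivity
      rw [Polynomial.derivative_monomial]
      simp [this]
  obtain ⟨Q, hQ⟩ := h
  refine ⟨Q + Polynomial.C (c - Q.eval 0), by simp [hQ], fun x => ?_⟩
  rw [primFrom, intervalIntegral.integral_eq_sub_of_hasDerivAt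
    (fun t _ => hQ ▸ Q.hasDerivAt t) (P.continuous.intervalIntegrable _ _)]
  simp
  ring

variable {α : Type*} [MeasurableSpace α] {μ : Measure α} {k l X : α → ℝ} {b x₀ : ℝ}

/-- The identity `b ψ(x₀) + ∫ l ψ(X) = ∫ k (Lψ)(X)`, where `L` is the operator `zonalOp n`
and `ψ'`, `ψ''` are the derivatives of `ψ`. -/
def ZonalIdentity (n : ℕ) (μ : Measure α) (k l X : α → ℝ) (b x₀ : ℝ) (ψ ψ' ψ'' : ℝ → ℝ) : Prop :=
  b * ψ x₀ + ∫ a, l a * ψ (X a) ∂μ = ∫ a, k a *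
    (-(X a * (1 - X a) * ψ'' (X a) + (n : ℝ) / 2 * (1 - 2 * X a) * ψ' (X a))) ∂μ

/-- With the initial values `c`, `c'` fixed, ψ' and ψ are iterated primitives of ψ'', so bounded
pointwise convergence of the second derivatives passes to them, and dominated convergence handles
both sides. -/
theorem ZonalIdentity.limit (hk : Integrable k μ) (hl : Integrable l μ) (hX : Measurable X)
    (hX' : ∀ a, X a ∈ Icc (0 : ℝ) 1) (hx₀ : x₀ ∈ Icc (0 : ℝ) 1) {c c' M : ℝ} {u : ℕ → ℝ → ℝ}
    {v : ℝ → ℝ} (hu : ∀ j, Continuous (u j)) (hM : ∀ j, ∀ x ∈ Icc (0 : ℝ) 1, |u j x| ≤ M)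
    (hlim : ∀ x ∈ Icc (0 : ℝ) 1, Tendsto (fun j => u j x) atTop (𝓝 (v x)))
    (h : ∀ j, ZonalIdentity n μ k l X b x₀ (primFrom c (primFrom c' (u j))) (primFrom c' (u j))
      (u j)) :
    ZonalIdentity n μ k l X b x₀ (primFrom c (primFrom c' v)) (primFrom c' v) v := by
  have hc1 : ∀ j, Continuous (primFrom c' (u j)) := fun j => continuous_primFrom _ (hu j)
  have hc2 : ∀ j, Continuous (primFrom c (primFrom c' (u j))) := fun j =>
    continuous_primFrom _ (hc1 j)
  have hM1 : ∀ j, ∀ x ∈ Icc (0 : ℝ) 1, |primFrom c' (u j) x| ≤ |c'| + M := fun j x hx =>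
    abs_primFrom_le (hM j) hx
  have hM2 : ∀ j, ∀ x ∈ Icc (0 : ℝ) 1, |primFrom c (primFrom c' (u j)) x| ≤ |c| + (|c'| + M) :=
    fun j x hx => abs_primFrom_le (hM1 j) hx
  have hl1 : ∀ x ∈ Icc (0 : ℝ) 1, Tendsto (fun j => primFrom c' (u j) x) atTop
      (𝓝 (primFrom c' v x)) := fun x hx =>
    tendsto_primFrom (fun j => (hu j).measurable) hM hlim hx
  have hl2 : ∀ x ∈ Icc (0 : ℝ) 1, Tendsto (fun j => primFrom c (primFrom c' (u j)) x) atTop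
      (𝓝 (primFrom c (primFrom c' v) x)) := fun x hx =>
    tendsto_primFrom (fun j => (hc1 j).measurable) hM1 hl1 hx
  have t1 := ((hl2 x₀ hx₀).const_mul b).add
    (tendsto_integral_comp hl hX hX' (fun j => (hc2 j).measurable) hM2 hl2)
  have t2 := tendsto_integral_comp hk hX hX'
    (f := fun j x => -(x * (1 - x) * u j x + (n : ℝ) / 2 * (1 - 2 * x) * primFrom c' (u j) x))
    (g := fun x => -(x * (1 - x) * v x + (n : ℝ) / 2 * (1 - 2 * x) * primFrom c' v x))
    (M := M + (n : ℝ) / 2 * (|c'| + M))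
    (fun j => by
      have := hu j
      have := hc1 j
      exact Continuous.measurable (by fun_prop))
    (fun j x hx => by
      have e1 : |x * (1 - x)| ≤ 1 := by
        rw [abs_of_nonneg (mul_nonneg hx.1 (by linarith [hx.2]))]
        nlinarith [hx.1, hx.2]
      have e2 : |1 - 2 * x| ≤ 1 := by rw [abs_le]; constructor <;> linarith [hx.1, hx.2]
      have e3 := hM j x hx
      have e4 := hM1 j x hx
      have e5 : (0 : ℝ) ≤ (n : ℝ) / 2 := by positivity
      rw [abs_neg]
      refine (abs_add_le _ _).trans (add_le_add ?_ ?_)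
      · rw [abs_mul]
        exact (mul_le_of_le_one_left (abs_nonneg _) e1).trans e3
      · rw [abs_mul, abs_mul, abs_of_nonneg e5, mul_assoc]
        exact mul_le_mul_of_nonneg_left
          ((mul_le_of_le_one_left (abs_nonneg _) e2).trans e4) e5)
    (fun x hx => (((hlim x hx).const_mul _).add ((hl1 x hx).const_mul _)).neg)
  exact tendsto_nhds_unique t1 (t2.congr fun j => (h j).symm)

/-- If the zonal identity holds for polynomials, it holds for every function whose second
derivative is a bounded pointwise limit of continuous functions. -/
theorem ZonalIdentity.of_polynomial (hk : Integrable k μ) (hl : Integrable l μ) (hX : Measurable X)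
    (hX' : ∀ a, X a ∈ Icc (0 : ℝ) 1) (hx₀ : x₀ ∈ Icc (0 : ℝ) 1)
    (hP : ∀ P : Polynomial ℝ, b * P.eval x₀ + ∫ a, l a * P.eval (X a) ∂μ
      = ∫ a, k a * (zonalOp n P).eval (X a) ∂μ)
    {c c' M : ℝ} {u : ℕ → ℝ → ℝ} {v : ℝ → ℝ} (hu : ∀ j, Continuous (u j))
    (hM : ∀ j, ∀ x ∈ Icc (0 : ℝ) 1, |u j x| ≤ M)
    (hlim : ∀ x ∈ Icc (0 : ℝ) 1, Tendsto (fun j => u j x) atTop (𝓝 (v x))) :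
    ZonalIdentity n μ k l X b x₀ (primFrom c (primFrom c' v)) (primFrom c' v) v := by
  -- Two limits in succession: polynomials to each continuous `u j` by Weierstrass, then `u j` to
  -- `v`.
  refine ZonalIdentity.limit hk hl hX hX' hx₀ hu hM hlim fun j => ?_
  obtain ⟨P, M', hM', hlim'⟩ := exists_polynomial_seq ((hu j).continuousOn (s := Icc 0 1))
  refine ZonalIdentity.limit hk hl hX hX' hx₀ (fun i => (P i).continuous) hM' hlim' fun i => ?_
  obtain ⟨Q, hQ, hQe⟩ := exists_polynomial_primFrom (P i) c'
  obtain ⟨R, hR, hRe⟩ := exists_polynomial_primFrom Q c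
  have e1 : primFrom c' (fun x => (P i).eval x) = fun x => Q.eval x := funext fun x => (hQe x).symm
  have e2 : primFrom c (fun x => Q.eval x) = fun x => R.eval x := funext fun x => (hRe x).symm
  rw [e1, e2, ZonalIdentity, hP R]
  simp only [eval_zonalOp, hR, hQ]

theorem primFrom_ite {ε : ℝ} (hε : ε ∈ Ioo (0 : ℝ) 1) {A B u₁ u₂ : ℝ → ℝ}
    (hA : ∀ x ∈ Icc 0 ε, HasDerivAt A (u₁ x) x) (hB : ∀ x ∈ Icc ε 1, HasDerivAt B (u₂ x) x)
    (h₁ : ContinuousOn u₁ (Icc 0 ε)) (h₂ : ContinuousOn u₂ (Icc ε 1)) (hAB : A ε = B ε) {x : ℝ}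
    (hx : x ∈ Icc (0 : ℝ) 1) :
    primFrom (A 0) (fun t => if t < ε then u₁ t else u₂ t) x = if x < ε then A x else B x := by
  have hleft : ∀ y ∈ Icc 0 ε,
      IntervalIntegrable (fun t => if t < ε then u₁ t else u₂ t) volume 0 y ∧
      ∫ t in (0 : ℝ)..y, (if t < ε then u₁ t else u₂ t) = A y - A 0 := by
    intro y hy
    have hsub : uIcc 0 y ⊆ Icc 0 ε := by
      rw [uIcc_of_le hy.1]; exact Icc_subset_Icc_right hy.2
    have hcongr : EqOn u₁ (fun t => if t < ε then u₁ t else u₂ t) (uIoo 0 y) := fun t ht => by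
      rw [uIoo_of_le hy.1] at ht
      simp [ht.2.trans_le hy.2]
    have hi : IntervalIntegrable u₁ volume 0 y := (h₁.mono hsub).intervalIntegrable
    refine ⟨hi.congr_uIoo hcongr, ?_⟩
    rw [← intervalIntegral.integral_congr_uIoo hcongr]
    exact intervalIntegral.integral_eq_sub_of_hasDerivAt (fun t ht => hA t (hsub ht)) hi
  rw [primFrom]
  split_ifs with hxe
  · rw [(hleft x ⟨hx.1, hxe.le⟩).2]; ring
  · rw [not_lt] at hxe
    have hsub : uIcc ε x ⊆ Icc ε 1 := by
      rw [uIcc_of_le hxe]; exact Icc_subset_Icc_right hx.2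
    have hcongr : EqOn u₂ (fun t => if t < ε then u₁ t else u₂ t) (uIoo ε x) := fun t ht => by
      rw [uIoo_of_le hxe] at ht
      simp [ht.1.not_gt]
    have hi : IntervalIntegrable u₂ volume ε x := (h₂.mono hsub).intervalIntegrable
    obtain ⟨hi0, he0⟩ := hleft ε ⟨hε.1.le, le_rfl⟩
    rw [← intervalIntegral.integral_add_adjacent_intervals hi0 (hi.congr_uIoo hcongr), he0,
      ← intervalIntegral.integral_congr_uIoo hcongr,
      intervalIntegral.integral_eq_sub_of_hasDerivAt (fun t ht => hB t (hsub ht)) hi, hAB]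
    ring

/-- The ratio of the volumes of the complementary cap and the cap. -/
noncomputable def capRatio (n : ℕ) (ε : ℝ) : ℝ := capBeta n (1 - ε) / capBeta n ε

/-- The zonal potential of a cap: a `C^1` function with `zonalOp n` equal to `capRatio n ε` on
`[0, ε)` and to `-1` on `(ε, 1]`. -/
noncomputable def capPotential (n : ℕ) (ε x : ℝ) : ℝ :=
  if x < ε then greenPrim n (1 - ε) + capRatio n ε * (greenPrim n ε - greenPrim n x)
  else greenPrim n (1 - x)

/-- The data `b`, `k`, `l` stay general because it serves twice: with k = φ, l = Δφ, b = 0 for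
existence of the Green function, and with k = G(p, ·), l = -1/V_n, b = 1 for the mean value formula.
-/
theorem zonalIdentity_capPotential (hn : 1 ≤ n) (hk : Integrable k μ) (hl : Integrable l μ)
    (hX : Measurable X) (hX' : ∀ a, X a ∈ Icc (0 : ℝ) 1) (hx₀ : x₀ ∈ Icc (0 : ℝ) 1)
    (hP : ∀ P : Polynomial ℝ, b * P.eval x₀ + ∫ a, l a * P.eval (X a) ∂μ
      = ∫ a, k a * (zonalOp n P).eval (X a) ∂μ) {ε : ℝ} (hε : ε ∈ Ioo (0 : ℝ) 1) :
    b * capPotential n ε x₀ + ∫ a, l a * capPotential n ε (X a) ∂μ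
      = ∫ a, k a * (if X a < ε then capRatio n ε else -1) ∂μ := by
  have hy := one_sub_mem_Ioo hε
  have habs1 : ∀ x ∈ Icc 0 ε, |x| < 1 := fun x hx => by
    rw [abs_of_nonneg hx.1]; exact hx.2.trans_lt hε.2
  have habs2 : ∀ x ∈ Icc ε 1, |1 - x| < 1 := fun x hx => by
    rw [abs_of_nonneg (by linarith [hx.2])]; linarith [hx.1, hε.1]
  have hd1 : ∀ x : ℝ, HasDerivAt (fun x : ℝ => 1 - x) (-1) x := fun x =>
    (hasDerivAt_id x).const_sub 1
  have hc := convergesOnUnit_greenCoeff hn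
  have hcont' : ContinuousOn (greenDeriv' n) (Ioo (-1) 1) := hc.derivCoeff.continuousOn
  have hcont : ContinuousOn (greenDeriv n) (Ioo (-1) 1) := hc.continuousOn
  have hcontl : ContinuousOn (greenDeriv' n) (Icc 0 ε) :=
    hcont'.mono fun x hx => abs_lt.1 (habs1 x hx)
  have hcontr : ContinuousOn (fun x => greenDeriv' n (1 - x)) (Icc ε 1) :=
    hcont'.comp (by fun_prop) fun x hx => abs_lt.1 (habs2 x hx)
  have hcontl0 : ContinuousOn (greenDeriv n) (Icc 0 ε) :=
    hcont.mono fun x hx => abs_lt.1 (habs1 x hx)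
  have hcontr0 : ContinuousOn (fun x => greenDeriv n (1 - x)) (Icc ε 1) :=
    hcont.comp (by fun_prop) fun x hx => abs_lt.1 (habs2 x hx)
  set κ := capRatio n ε with hκ
  let u₁ : ℝ → ℝ := fun x => -κ * greenDeriv' n x
  let u₂ : ℝ → ℝ := fun x => greenDeriv' n (1 - x)
  let A₁ : ℝ → ℝ := fun x => -κ * greenDeriv n x
  let B₁ : ℝ → ℝ := fun x => -greenDeriv n (1 - x)
  let A₀ : ℝ → ℝ := fun x => greenPrim n (1 - ε) + κ * (greenPrim n ε - greenPrim n x)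
  let B₀ : ℝ → ℝ := fun x => greenPrim n (1 - x)
  have hA₁ : ∀ x ∈ Icc 0 ε, HasDerivAt A₁ (u₁ x) x := fun x hx =>
    (hasDerivAt_greenDeriv hn (habs1 x hx)).const_mul _
  have hB₁ : ∀ x ∈ Icc ε 1, HasDerivAt B₁ (u₂ x) x := fun x hx => by
    refine ((hasDerivAt_greenDeriv hn (habs2 x hx)).comp x (hd1 x)).neg.congr_deriv ?_
    simp [u₂]
  have hA₀ : ∀ x ∈ Icc 0 ε, HasDerivAt A₀ (A₁ x) x := fun x hx => by
    refine ((((hasDerivAt_greenPrim hn (habs1 x hx)).const_sub _).const_mul _).const_add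
      _).congr_deriv ?_
    simp [A₁]
  have hB₀ : ∀ x ∈ Icc ε 1, HasDerivAt B₀ (B₁ x) x := fun x hx => by
    refine ((hasDerivAt_greenPrim hn (habs2 x hx)).comp x (hd1 x)).congr_deriv ?_
    simp [B₁]
  -- The C¹ matching at ε is what dictates κ: after multiplication by `betaFlux`, both derivatives
  -- become -`capBeta n (1 - ε)`.
  have hAB₁ : A₁ ε = B₁ ε := by
    have h1 := betaFlux_mul_greenDeriv hn hε
    have h2 := capBeta_eq_betaFlux_mul hn ⟨hε.1.le, hε.2⟩
    have h3 := (capBeta_pos hn hε.1 hε.2.le).ne'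
    have h4 := (betaFlux_pos (n := n) hε).ne'
    simp only [A₁, B₁, hκ, capRatio]
    rw [h2] at h3 ⊢
    rw [← h1]
    have h5 := right_ne_zero_of_mul h3
    field_simp
  have hAB₀ : A₀ ε = B₀ ε := by simp [A₀, B₀]
  let u : ℝ → ℝ := fun x => if x < ε then u₁ x else u₂ x
  have hp1 : ∀ x ∈ Icc (0 : ℝ) 1, primFrom (A₁ 0) u x = if x < ε then A₁ x else B₁ x :=
    fun x hx => primFrom_ite hε hA₁ hB₁ (continuousOn_const.mul hcontl) hcontr hAB₁ hx
  have hp0 : ∀ x ∈ Icc (0 : ℝ) 1, primFrom (A₀ 0) (primFrom (A₁ 0) u) x = capPotential n ε x :=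
    fun x hx => by
      rw [primFrom_congr hp1 hx]
      exact primFrom_ite hε hA₀ hB₀ (continuousOn_const.mul hcontl0) hcontr0.neg hAB₀ hx
  -- Each branch of the second derivative is controlled only on its own closed interval; clamping
  -- the argument makes it continuous on the whole line.
  let v₁ : ℝ → ℝ := fun x => u₁ (max 0 (min x ε))
  let v₂ : ℝ → ℝ := fun x => u₂ (max ε (min x 1))
  have hv₁ : Continuous v₁ := by
    refine (continuousOn_const.mul hcontl).comp_continuous (by fun_prop) fun x => ?_
    exact ⟨le_max_left _ _, max_le hε.1.le (min_le_right _ _)⟩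
  have hv₂ : Continuous v₂ := by
    refine hcontr.comp_continuous (by fun_prop) fun x => ?_
    exact ⟨le_max_left _ _, max_le hε.2.le (min_le_right _ _)⟩
  -- A ramp placed to the left of ε and equal to 1 at ε, so that the limit takes the right-hand
  -- branch there, as the test `x < ε` does.
  let θ : ℕ → ℝ → ℝ := fun j x => max 0 (min 1 (1 + j * (x - ε)))
  have hθ : ∀ j x, 0 ≤ θ j x ∧ θ j x ≤ 1 := fun j x =>
    ⟨le_max_left _ _, max_le zero_le_one (min_le_left _ _)⟩
  obtain ⟨C₁, hC₁⟩ := (isCompact_Icc (a := (0 : ℝ)) (b := 1)).exists_bound_of_continuousOn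
    hv₁.continuousOn
  obtain ⟨C₂, hC₂⟩ := (isCompact_Icc (a := (0 : ℝ)) (b := 1)).exists_bound_of_continuousOn
    hv₂.continuousOn
  have key := ZonalIdentity.of_polynomial (n := n) (μ := μ) (k := k) (l := l) (X := X) (b := b)
    (x₀ := x₀) hk hl hX hX' hx₀ hP (c := A₀ 0) (c' := A₁ 0) (v := u) (M := C₁ + C₂)
    (u := fun j x => (1 - θ j x) * v₁ x + θ j x * v₂ x)
    (fun j => by fun_prop)
    (fun j x hx => by
      have h1 := hC₁ x hx
      have h2 := hC₂ x hx
      rw [Real.norm_eq_abs] at h1 h2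
      obtain ⟨h3, h4⟩ := hθ j x
      refine (abs_add_le _ _).trans (add_le_add ?_ ?_)
      · rw [abs_mul, abs_of_nonneg (by linarith)]
        exact (mul_le_of_le_one_left (abs_nonneg _) (by linarith)).trans h1
      · rw [abs_mul, abs_of_nonneg h3]
        exact (mul_le_of_le_one_left (abs_nonneg _) h4).trans h2)
    (fun x hx => by
      by_cases hxe : x < ε
      · have hlim : Tendsto (fun j : ℕ => 1 + (j : ℝ) * (x - ε)) atTop atBot :=
          tendsto_atBot_add_const_left _ _
            (tendsto_natCast_atTop_atTop.atTop_mul_const_of_neg (by linarith))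
        refine tendsto_const_nhds.congr' ?_
        filter_upwards [hlim.eventually_le_atBot 0] with j hj
        have : θ j x = 0 := by
          simp only [θ]
          rw [max_eq_left ((min_le_right _ _).trans hj)]
        simp [this, u, hxe, v₁, min_eq_left hxe.le, max_eq_right hx.1]
      · rw [not_lt] at hxe
        refine tendsto_const_nhds.congr fun j => ?_
        have h0 : (0 : ℝ) ≤ j * (x - ε) := mul_nonneg (Nat.cast_nonneg j) (by linarith)
        have : θ j x = 1 := by
          simp only [θ]
          rw [min_eq_left (by linarith), max_eq_right zero_le_one]
        simp [this, u, hxe.not_gt, v₂, min_eq_left hx.2, max_eq_right hxe])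
  rw [ZonalIdentity] at key
  simp only [hp0 _ hx₀, hp0 _ (hX' _), hp1 _ (hX' _)] at key
  rw [key]
  refine integral_congr_ae (Eventually.of_forall fun a => ?_)
  simp only [u]
  congr 1
  split_ifs with hxe
  · have := greenDeriv_ode hn (habs1 (X a) ⟨(hX' a).1, hxe.le⟩)
    simp only [u₁, A₁]
    linear_combination κ * this
  · rw [not_lt] at hxe
    have := greenDeriv_ode hn (habs2 (X a) ⟨hxe, (hX' a).2⟩)
    simp only [u₂, B₁]
    linear_combination -this

end ZonalIdentity

/-! ### The closed form is a Green function -/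

section ExplicitGreen

open Filter Topology Set

variable {n : ℕ}

/-- The cap of points whose pole coordinate with respect to `v` is less than `ε`. -/
def poleCap (v : USphere n) (ε : ℝ) : Set (USphere n) := {q | poleCoord v q < ε}

theorem isOpen_poleCap (v : USphere n) (ε : ℝ) : IsOpen (poleCap v ε) :=
  isOpen_lt (continuous_poleCoord v) continuous_const

theorem poleCoord_self (v : USphere n) : poleCoord v v = 0 := by
  simp [poleCoord]

theorem poleCoord_pos {p q : USphere n} (h : p ≠ q) : 0 < poleCoord p q := by
  have := (inner_lt_one_iff_real_of_norm_eq_one p.norm_coe q.norm_coe).2 fun e => h (Subtype.ext e)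
  rw [poleCoord]
  linarith

theorem poleCoord_neg (v q : USphere n) : poleCoord (-v) q = 1 - poleCoord v q := by
  simp only [poleCoord, coe_neg_sphere, inner_neg_left]
  ring

theorem dist_sq_eq_poleCoord (v q : USphere n) : dist q v ^ 2 = 4 * poleCoord v q := by
  rw [Subtype.dist_eq, dist_eq_norm, norm_sub_sq_real, q.norm_coe, v.norm_coe, poleCoord,
    real_inner_comm]
  ring

theorem eventually_poleCap {v : USphere n} {s : Set (USphere n)} (hs : s ∈ 𝓝 v) :
    ∃ δ > 0, poleCap v δ ⊆ s := by
  obtain ⟨r, hr, hrs⟩ := Metric.mem_nhds_iff.1 hs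
  refine ⟨r ^ 2 / 4, by positivity, fun q hq => hrs ?_⟩
  have h := dist_sq_eq_poleCoord v q
  have hq' : poleCoord v q < r ^ 2 / 4 := hq
  exact lt_of_pow_lt_pow_left₀ 2 hr.le (by linarith)

/-- Latitude spheres are null because the law of the pole coordinate has a density. -/
theorem ae_poleCoord_ne (hn : 1 ≤ n) (v : USphere n) (x : ℝ) :
    ∀ᵐ q ∂(sphereMeasure n), poleCoord v q ≠ x := by
  have h : ∀ᵐ y ∂(sphereMeasure n).map (poleCoord v), y ≠ x := by
    rw [map_poleCoord hn]
    refine Measure.ae_smul_measure ?_ _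
    exact (withDensity_absolutelyContinuous _ _).ae_le (ae_restrict_of_ae (Measure.ae_ne _ x))
  exact ae_of_ae_map (continuous_poleCoord v).measurable.aemeasurable h

theorem sphereMeasure_real_poleCap (hn : 1 ≤ n) (v : USphere n) {ε : ℝ} (hε : ε ∈ Icc (0 : ℝ) 1) :
    (sphereMeasure n).real (poleCap v ε) = capConst n * capBeta n ε := by
  have h := integral_comp_poleCoord hn v (f := (Iio ε).indicator 1)
    (measurable_one.indicator measurableSet_Iio)
  have e1 : (fun q : USphere n => (Iio ε).indicator (1 : ℝ → ℝ) (poleCoord v q))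
      = (poleCap v ε).indicator 1 := by
    ext q
    by_cases hq : poleCoord v q < ε <;> simp [indicator, poleCap, hq]
  rw [e1, integral_indicator_one (isOpen_poleCap v ε).measurableSet] at h
  rw [h, capBeta_eq]
  congr 1
  have hi : ∀ a ∈ Icc (0 : ℝ) 1, ∀ b ∈ Icc (0 : ℝ) 1,
      IntervalIntegrable (fun x => betaWeight n x * (Iio ε).indicator 1 x) volume a b := by
    intro a ha b hb
    refine (intervalIntegrable_betaWeight hn ha hb).mono_fun ?_ (Eventually.of_forall fun x => ?_)
    · exact (measurable_betaWeight.mul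
        (measurable_one.indicator measurableSet_Iio)).aestronglyMeasurable
    · by_cases hx : x < ε <;> simp [indicator, hx]
  rw [← intervalIntegral.integral_add_adjacent_intervals (hi 0 (by simp) ε hε)
    (hi ε hε 1 (by simp))]
  have e2 : ∫ x in (0 : ℝ)..ε, betaWeight n x * (Iio ε).indicator 1 x
      = ∫ x in (0 : ℝ)..ε, betaWeight n x :=
    intervalIntegral.integral_congr_Ioo_of_le hε.1 fun x hx => by simp [indicator, hx.2]
  have e3 : ∫ x in ε..1, betaWeight n x * (Iio ε).indicator 1 x = ∫ x in ε..1, (0 : ℝ) :=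
    intervalIntegral.integral_congr_Ioo_of_le hε.2 fun x hx => by simp [indicator, hx.1.not_gt]
  rw [e2, e3]
  simp

/-- The mean of `greenPrim` over the sphere. -/
noncomputable def greenMean (n : ℕ) : ℝ := capInt n 1 / capBeta n 1

/-- The Green function of the sphere in closed form. -/
noncomputable def explicitGreen (n : ℕ) (p q : USphere n) : ℝ :=
  (sphereVol n)⁻¹ * (greenPrim n (1 - poleCoord p q) - greenMean n)

theorem intervalIntegrable_greenPrim_flip (hn : 1 ≤ n) :
    IntervalIntegrable (fun x => betaWeight n x * greenPrim n (1 - x)) volume 0 1 := by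
  have h := ((intervalIntegrable_betaWeight_mul_greenPrim hn).comp_sub_left 1).symm
  simpa only [betaWeight_one_sub, sub_zero, sub_self] using h

theorem integral_greenPrim_flip : ∫ x in (0 : ℝ)..1, betaWeight n x * greenPrim n (1 - x)
    = capInt n 1 := by
  rw [capInt]
  have h := intervalIntegral.integral_comp_sub_left
    (f := fun x => betaWeight n x * greenPrim n x) (a := 0) (b := 1) 1
  simpa only [betaWeight_one_sub, sub_zero, sub_self] using h

theorem measurable_greenPrim_flip (hn : 1 ≤ n) : Measurable fun x => greenPrim n (1 - x) :=
  (measurable_greenPrim hn).comp (by fun_prop)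

theorem integrable_greenPrim_poleCoord (hn : 1 ≤ n) (p : USphere n) :
    Integrable (fun q => greenPrim n (1 - poleCoord p q)) (sphereMeasure n) :=
  integrable_comp_poleCoord hn p (measurable_greenPrim_flip hn)
    (intervalIntegrable_greenPrim_flip hn)

theorem integral_greenPrim_poleCoord (hn : 1 ≤ n) (p : USphere n) :
    ∫ q, greenPrim n (1 - poleCoord p q) ∂(sphereMeasure n) = capConst n * capInt n 1 := by
  rw [integral_comp_poleCoord hn p (measurable_greenPrim_flip hn), integral_greenPrim_flip]

theorem integrable_explicitGreen (hn : 1 ≤ n) (p : USphere n) :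
    Integrable (explicitGreen n p) (sphereMeasure n) :=
  ((integrable_greenPrim_poleCoord hn p).sub (integrable_const _)).const_mul _

theorem integral_explicitGreen (hn : 1 ≤ n) (p : USphere n) :
    ∫ q, explicitGreen n p q ∂(sphereMeasure n) = 0 := by
  have h1 := (capBeta_pos hn one_pos le_rfl).ne'
  have h2 : (sphereMeasure n).real univ = capConst n * capBeta n 1 := sphereVol_eq_capConst hn
  simp only [explicitGreen]
  rw [integral_const_mul, integral_sub (integrable_greenPrim_poleCoord hn p) (integrable_const _),
    integral_greenPrim_poleCoord hn, integral_const, h2, greenMean, smul_eq_mul]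
  field_simp
  simp

theorem continuousOn_explicitGreen (hn : 1 ≤ n) :
    ContinuousOn (fun x : USphere n × USphere n => explicitGreen n x.1 x.2) {x | x.1 ≠ x.2} := by
  have hc : Continuous fun x : USphere n × USphere n => 1 - poleCoord x.1 x.2 := by
    unfold poleCoord; fun_prop
  have h := (continuousOn_greenPrim hn).comp (s := {x : USphere n × USphere n | x.1 ≠ x.2})
    hc.continuousOn fun x hx =>
      ⟨by linarith [(poleCoord_mem_Icc x.1 x.2).2], by linarith [poleCoord_pos hx]⟩
  exact continuousOn_const.mul (h.sub continuousOn_const)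

theorem capRatio_add_one (hn : 1 ≤ n) {ε : ℝ} (hε : ε ∈ Ioo (0 : ℝ) 1) :
    capRatio n ε + 1 = capBeta n 1 / capBeta n ε := by
  have := (capBeta_pos hn hε.1 hε.2.le).ne'
  rw [capRatio, capBeta_one_sub hn ⟨hε.1.le, hε.2.le⟩]
  field_simp
  ring

theorem capRatio_pos (hn : 1 ≤ n) {ε : ℝ} (hε : ε ∈ Ioo (0 : ℝ) 1) : 0 < capRatio n ε :=
  div_pos (capBeta_pos hn (one_sub_mem_Ioo hε).1 (one_sub_mem_Ioo hε).2.le)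
    (capBeta_pos hn hε.1 hε.2.le)

theorem capPotential_nonneg (hn : 1 ≤ n) {ε : ℝ} (hε : ε ∈ Ioo (0 : ℝ) 1) {x : ℝ}
    (hx : x ∈ Icc (0 : ℝ) 1) : 0 ≤ capPotential n ε x := by
  rw [capPotential]
  split_ifs with h
  · have h1 := greenPrim_nonneg hn (one_sub_mem_Ioo hε).1.le
    have h2 := greenPrim_monotoneOn hn ⟨hx.1, h.trans hε.2⟩ ⟨hε.1.le, hε.2⟩ h.le
    have h3 := mul_nonneg (capRatio_pos hn hε).le (sub_nonneg.2 h2)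
    linarith
  · exact greenPrim_nonneg hn (by linarith [hx.2])

/-- Inside the cap the difference of the two sides decreases to 0 at ε; the sign of its derivative
follows, after multiplication by `betaFlux`, from monotonicity of `capBeta`. This is the domination
for ε → 0. The pole x = 0 is excluded because `greenPrim n 1` is the default 0. -/
theorem capPotential_le (hn : 1 ≤ n) {ε : ℝ} (hε : ε ∈ Ioo (0 : ℝ) 1) {x : ℝ} (hx : 0 < x) :
    capPotential n ε x ≤ greenPrim n (1 - x) := by
  rw [capPotential]
  split_ifs with h
  · have hd : ∀ t ∈ Icc x ε, HasDerivAt (fun t => greenPrim n (1 - t) + capRatio n ε * greenPrim n t)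
        (greenDeriv n (1 - t) * (-1) + capRatio n ε * greenDeriv n t) t := fun t ht => by
      have ht' : t ∈ Ioo (0 : ℝ) 1 := ⟨hx.trans_le ht.1, ht.2.trans_lt hε.2⟩
      have h1 : |t| < 1 := by rw [abs_of_pos ht'.1]; exact ht'.2
      have h2 : |1 - t| < 1 := by
        rw [abs_of_pos (one_sub_mem_Ioo ht').1]; exact (one_sub_mem_Ioo ht').2
      exact ((hasDerivAt_greenPrim hn h2).comp t ((hasDerivAt_id t).const_sub 1)).add
        ((hasDerivAt_greenPrim hn h1).const_mul _)
    have hanti := antitoneOn_of_deriv_nonpos (convex_Icc x ε)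
      (fun t ht => (hd t ht).continuousAt.continuousWithinAt)
      (fun t ht => (hd t (interior_subset ht)).differentiableAt.differentiableWithinAt)
      (fun t ht => by
        have ht := interior_subset ht
        rw [(hd t ht).deriv]
        have ht' : t ∈ Ioo (0 : ℝ) 1 := ⟨hx.trans_le ht.1, ht.2.trans_lt hε.2⟩
        have hflux := betaFlux_pos (n := n) ht'
        have e1 := betaFlux_mul_greenDeriv hn ht'
        have e2 := capBeta_eq_betaFlux_mul hn ⟨ht'.1.le, ht'.2⟩
        have hIε := capBeta_pos hn hε.1 hε.2.le
        have m1 : capBeta n t ≤ capBeta n ε := (capBeta_strictMonoOn hn).monotoneOn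
          ⟨ht'.1.le, ht'.2.le⟩ ⟨hε.1.le, hε.2.le⟩ ht.2
        have m2 : capBeta n (1 - ε) ≤ capBeta n (1 - t) := (capBeta_strictMonoOn hn).monotoneOn
          ⟨(one_sub_mem_Ioo hε).1.le, (one_sub_mem_Ioo hε).2.le⟩
          ⟨(one_sub_mem_Ioo ht').1.le, (one_sub_mem_Ioo ht').2.le⟩ (by linarith [ht.2])
        have m3 : capRatio n ε * capBeta n t ≤ capBeta n (1 - t) := by
          refine le_trans ?_ m2
          rw [capRatio, div_mul_eq_mul_div, div_le_iff₀ hIε]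
          exact mul_le_mul_of_nonneg_left m1
            (capBeta_pos hn (one_sub_mem_Ioo hε).1 (one_sub_mem_Ioo hε).2.le).le
        rw [← e1, e2] at m3
        have : betaFlux n t * (greenDeriv n (1 - t) * (-1) + capRatio n ε * greenDeriv n t) ≤ 0 := by
          linarith
        exact nonpos_of_mul_nonpos_right this hflux)
    have := hanti ⟨le_rfl, h.le⟩ ⟨h.le, le_rfl⟩ h.le
    simp only at this
    linarith
  · rfl

theorem measurable_capPotential (hn : 1 ≤ n) (ε : ℝ) : Measurable (capPotential n ε) :=
  Measurable.ite measurableSet_Iio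
    (measurable_const.add (measurable_const.mul (measurable_const.sub (measurable_greenPrim hn))))
    (measurable_greenPrim_flip hn)

theorem integral_capRatio_add_one (hn : 1 ≤ n) (p : USphere n) {ε : ℝ} (hε : ε ∈ Ioo (0 : ℝ) 1) :
    ∫ q, (poleCap p ε).indicator (fun _ => capRatio n ε + 1) q ∂(sphereMeasure n)
      = sphereVol n := by
  have h := (capBeta_pos hn hε.1 hε.2.le).ne'
  rw [integral_indicator_const _ (isOpen_poleCap p ε).measurableSet,
    sphereMeasure_real_poleCap hn p ⟨hε.1.le, hε.2.le⟩, capRatio_add_one hn hε,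
    sphereVol_eq_capConst hn, smul_eq_mul]
  field_simp

/-- The step function is (κ+1)·1_cap - 1, and its first part is an approximate identity of total
mass V_n. -/
theorem tendsto_integral_cap (hn : 1 ≤ n) {φ : USphere n → ℝ} (hφ : Continuous φ) (p : USphere n)
    {e : ℕ → ℝ} (he : ∀ j, e j ∈ Ioo (0 : ℝ) 1) (hlim : Tendsto e atTop (𝓝 0)) :
    Tendsto (fun j => ∫ q, φ q * (if poleCoord p q < e j then capRatio n (e j) else -1)
      ∂(sphereMeasure n)) atTop (𝓝 (sphereVol n * φ p - ∫ q, φ q ∂(sphereMeasure n))) := by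
  rw [Metric.tendsto_atTop]
  intro η hη
  have hV := sphereVol_pos (n := n)
  obtain ⟨δ, hδ, hsub⟩ := eventually_poleCap
    (hφ.continuousAt.preimage_mem_nhds (Metric.ball_mem_nhds (φ p) (by positivity :
      0 < η / (2 * sphereVol n))))
  obtain ⟨N, hN⟩ := (hlim.eventually (gt_mem_nhds hδ)).exists_forall_of_atTop
  refine ⟨N, fun j hj => ?_⟩
  let D : USphere n → ℝ := (poleCap p (e j)).indicator fun _ => capRatio n (e j) + 1
  have hDint : Integrable D (sphereMeasure n) :=
    (integrable_const _).indicator (isOpen_poleCap p _).measurableSet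
  have hD0 : ∀ q, 0 ≤ D q := fun q =>
    indicator_nonneg (fun _ _ => by linarith [capRatio_pos hn (he j)]) q
  have hφD : Integrable (fun q => φ q * D q) (sphereMeasure n) := by
    obtain ⟨C, hC⟩ := isCompact_univ.exists_bound_of_continuousOn hφ.continuousOn
    exact hDint.bdd_mul hφ.aestronglyMeasurable
      (Eventually.of_forall fun q => hC q (mem_univ q))
  have e1 : ∫ q, φ q * (if poleCoord p q < e j then capRatio n (e j) else -1) ∂(sphereMeasure n)
      = ∫ q, φ q * D q ∂(sphereMeasure n) - ∫ q, φ q ∂(sphereMeasure n) := by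
    rw [← integral_sub hφD (continuous_integrable_sphere hφ)]
    refine integral_congr_ae (Eventually.of_forall fun q => ?_)
    by_cases hq : poleCoord p q < e j <;> simp [D, poleCap, hq]
    ring
  have e2 : sphereVol n * φ p = ∫ q, φ p * D q ∂(sphereMeasure n) := by
    rw [integral_const_mul, integral_capRatio_add_one hn p (he j), mul_comm]
  rw [e1, e2, dist_eq_norm, sub_sub_sub_cancel_right,
    ← integral_sub hφD (hDint.const_mul _)]
  have hbound : ∀ q, ‖φ q * D q - φ p * D q‖ ≤ η / (2 * sphereVol n) * D q := fun q => by
    by_cases hq : q ∈ poleCap p (e j)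
    · have hq' : φ q ∈ Metric.ball (φ p) (η / (2 * sphereVol n)) :=
        hsub (lt_trans (show poleCoord p q < e j from hq) (hN j hj))
      rw [← sub_mul, norm_mul, Real.norm_of_nonneg (hD0 q)]
      rw [Metric.mem_ball, dist_eq_norm] at hq'
      exact mul_le_mul_of_nonneg_right hq'.le (hD0 q)
    · simp [D, hq]
  calc _ ≤ ∫ q, η / (2 * sphereVol n) * D q ∂(sphereMeasure n) :=
        norm_integral_le_of_norm_le (hDint.const_mul _) (Eventually.of_forall hbound)
    _ = η / 2 := by
        rw [integral_const_mul, integral_capRatio_add_one hn p (he j)]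
        field_simp
    _ < η := by linarith

theorem integral_laplaceBeltrami {φ : USphere n → ℝ} (hφ : ContMDiff (𝓡 n) 𝓘(ℝ, ℝ) ∞ φ)
    (p : USphere n) : ∫ q, laplaceBeltrami φ q ∂(sphereMeasure n) = 0 := by
  have h := integral_polynomial_mul_laplaceBeltrami hφ 1 p
  simp only [eval_zonalOp] at h
  simpa using h

/-- Shrinking caps: the potentials converge off the pole to F(1-x), which also dominates them, while
their images under the operator converge weakly to V_n δ_p - 1. -/
theorem integral_greenPrim_mul_laplaceBeltrami (hn : 1 ≤ n) {φ : USphere n → ℝ}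
    (hφ : ContMDiff (𝓡 n) 𝓘(ℝ, ℝ) ∞ φ) (p : USphere n) :
    ∫ q, laplaceBeltrami φ q * greenPrim n (1 - poleCoord p q) ∂(sphereMeasure n)
      = sphereVol n * φ p - ∫ q, φ q ∂(sphereMeasure n) := by
  have hL := continuous_laplaceBeltrami hφ
  let e : ℕ → ℝ := fun j => 1 / ((j : ℝ) + 2)
  have he : ∀ j, e j ∈ Ioo (0 : ℝ) 1 := fun j => by
    have : (0 : ℝ) ≤ j := Nat.cast_nonneg j
    refine ⟨by positivity, ?_⟩
    rw [div_lt_one (by positivity)]; linarith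
  have hlim : Tendsto e atTop (𝓝 0) := tendsto_const_nhds.div_atTop
    (tendsto_atTop_add_const_right _ _ tendsto_natCast_atTop_atTop)
  have hid : ∀ j, ∫ q, laplaceBeltrami φ q * capPotential n (e j) (poleCoord p q) ∂(sphereMeasure n)
      = ∫ q, φ q * (if poleCoord p q < e j then capRatio n (e j) else -1) ∂(sphereMeasure n) := by
    intro j
    have h := zonalIdentity_capPotential (n := n) (b := 0) (x₀ := 0) hn
      (continuous_integrable_sphere hφ.continuous) (continuous_integrable_sphere hL)
      (continuous_poleCoord p).measurable (poleCoord_mem_Icc p) (by simp)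
      (fun P => by
        rw [zero_mul, zero_add]
        simp only [mul_comm (laplaceBeltrami φ _), mul_comm (φ _)]
        exact integral_polynomial_mul_laplaceBeltrami hφ P p) (he j)
    simpa using h
  have t1 := tendsto_integral_cap hn hφ.continuous p he hlim
  simp only [← hid] at t1
  refine tendsto_nhds_unique (tendsto_integral_of_dominated_convergence
    (fun q => |laplaceBeltrami φ q| * greenPrim n (1 - poleCoord p q))
    (fun j => hL.aestronglyMeasurable.mul ((measurable_capPotential hn (e j)).comp
      (continuous_poleCoord p).measurable).aestronglyMeasurable) ?_
    (fun j => ?_) ?_) t1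
  · obtain ⟨C, hC⟩ := isCompact_univ.exists_bound_of_continuousOn hL.abs.continuousOn
    exact (integrable_greenPrim_poleCoord hn p).bdd_mul hL.abs.aestronglyMeasurable
      (Eventually.of_forall fun q => hC q (mem_univ q))
  · filter_upwards [ae_poleCoord_ne hn p 0] with q hq
    have hq0 := lt_of_le_of_ne (poleCoord_mem_Icc p q).1 hq.symm
    change ‖laplaceBeltrami φ q * capPotential n (e j) (poleCoord p q)‖ ≤ _
    rw [norm_mul, Real.norm_eq_abs,
      Real.norm_of_nonneg (capPotential_nonneg hn (he j) (poleCoord_mem_Icc p q))]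
    exact mul_le_mul_of_nonneg_left (capPotential_le hn (he j) hq0) (abs_nonneg _)
  · filter_upwards [ae_poleCoord_ne hn p 0] with q hq
    have hq0 := lt_of_le_of_ne (poleCoord_mem_Icc p q).1 hq.symm
    refine tendsto_const_nhds.congr' ?_
    filter_upwards [hlim.eventually (gt_mem_nhds hq0)] with j hj
    change _ = laplaceBeltrami φ q * capPotential n (e j) (poleCoord p q)
    rw [capPotential, if_neg (not_lt.2 hj.le)]

theorem isGreenFunction_explicitGreen (hn : 1 ≤ n) : IsGreenFunction n (explicitGreen n) where
  continuousOn := continuousOn_explicitGreen hn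
  integrable := integrable_explicitGreen hn
  symm p q := by rw [explicitGreen, explicitGreen, poleCoord_comm]
  mean_zero := integral_explicitGreen hn
  laplacian p φ hφ := by
    have hL := continuous_laplaceBeltrami hφ
    have hV := (sphereVol_pos (n := n)).ne'
    have hi : Integrable (fun q => laplaceBeltrami φ q * greenPrim n (1 - poleCoord p q))
        (sphereMeasure n) := by
      obtain ⟨C, hC⟩ := isCompact_univ.exists_bound_of_continuousOn hL.continuousOn
      exact (integrable_greenPrim_poleCoord hn p).bdd_mul hL.aestronglyMeasurable
        (Eventually.of_forall fun q => hC q (mem_univ q))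
    have e : ∀ q, explicitGreen n p q * laplaceBeltrami φ q
        = (sphereVol n)⁻¹ * (laplaceBeltrami φ q * greenPrim n (1 - poleCoord p q)
          - greenMean n * laplaceBeltrami φ q) := fun q => by rw [explicitGreen]; ring
    simp only [e]
    rw [integral_const_mul, integral_sub hi ((continuous_integrable_sphere hL).const_mul _),
      integral_const_mul, integral_laplaceBeltrami hφ p,
      integral_greenPrim_mul_laplaceBeltrami hn hφ]
    field_simp
    ring

end ExplicitGreen

/-! ### Uniqueness of the Green function off the diagonal -/

section Uniqueness

open Filter Topology Set

variable {n : ℕ}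

/-- A function orthogonal to all continuous functions of the pole coordinate vanishes at the pole
if it is continuous there. -/
theorem eq_zero_of_integral_poleCoord_eq_zero {H : USphere n → ℝ} {v : USphere n}
    (hH : Integrable H (sphereMeasure n)) (hc : ContinuousAt H v)
    (h : ∀ f : ℝ → ℝ, Continuous f → ∫ q, H q * f (poleCoord v q) ∂(sphereMeasure n) = 0) :
    H v = 0 := by
  have key : ∀ K : USphere n → ℝ, Integrable K (sphereMeasure n) → ContinuousAt K v →
      (∀ f : ℝ → ℝ, Continuous f → ∫ q, K q * f (poleCoord v q) ∂(sphereMeasure n) = 0) →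
      ¬ 0 < K v := by
    intro K hK hc h hpos
    obtain ⟨δ, hδ, hsub⟩ := eventually_poleCap (hc.preimage_mem_nhds (Ioi_mem_nhds hpos))
    have hnn : ∀ q, 0 ≤ K q * max 0 (δ - poleCoord v q) := fun q => by
      by_cases hq : poleCoord v q < δ
      · exact mul_nonneg (le_of_lt (hsub hq)) (le_max_left _ _)
      · rw [max_eq_left (by linarith), mul_zero]
    have hi : Integrable (fun q => K q * max 0 (δ - poleCoord v q)) (sphereMeasure n) := by
      refine hK.mul_bdd (c := δ) (by fun_prop) (Eventually.of_forall fun q => ?_)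
      rw [Real.norm_of_nonneg (le_max_left _ _)]
      exact max_le hδ.le (by linarith [(poleCoord_mem_Icc v q).1])
    -- A continuous test function positive exactly on the cap, where `K` is positive; a zero
    -- integral would make the nonempty open cap null.
    have h0 := h (fun x => max 0 (δ - x)) (by fun_prop)
    have hae := (integral_eq_zero_iff_of_nonneg hnn hi).1 h0
    have hcap : sphereMeasure n (poleCap v δ) = 0 := by
      refine measure_mono_null (fun q hq => ?_) (ae_iff.1 hae)
      have h1 : 0 < K q := hsub hq
      have h2 : poleCoord v q < δ := hq
      exact (mul_pos h1 (lt_max_of_lt_right (by linarith))).ne'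
    exact ((isOpen_poleCap v δ).measure_pos _ ⟨v, by
      change poleCoord v v < δ
      rwa [poleCoord_self]⟩).ne' hcap
  refine le_antisymm (not_lt.1 (key H hH hc h)) (not_lt.1 fun hneg => ?_)
  refine key (fun q => -H q) hH.neg hc.neg (fun f hf => ?_) (by simpa using hneg)
  simp only [neg_mul, integral_neg, h f hf, neg_zero]

/-- A weakly harmonic function of mean zero kills 1 and the range of `zonalOp`, hence all
polynomials in the coordinate about any pole, hence by density all continuous functions of it. -/
theorem integral_mul_poleCoord_eq_zero (hn : 1 ≤ n) {H : USphere n → ℝ}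
    (hH : Integrable H (sphereMeasure n)) (h1 : ∫ q, H q ∂(sphereMeasure n) = 0)
    (hL : ∀ φ : USphere n → ℝ, ContMDiff (𝓡 n) 𝓘(ℝ, ℝ) ∞ φ →
      ∫ q, H q * laplaceBeltrami φ q ∂(sphereMeasure n) = 0) (v : USphere n)
    {f : ℝ → ℝ} (hf : Continuous f) :
    ∫ q, H q * f (poleCoord v q) ∂(sphereMeasure n) = 0 := by
  have hX := (continuous_poleCoord v).measurable
  have hP : ∀ P : Polynomial ℝ, ∫ q, H q * P.eval (poleCoord v q) ∂(sphereMeasure n) = 0 :=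
    eq_zero_of_zonalOp_eq_zero hn
      (isLinearMap_integral_polynomial hH hX (poleCoord_mem_Icc v)) (by simpa using h1) fun P => by
        simpa only [laplaceBeltrami_polynomial] using hL _ (contMDiff_polynomial_poleCoord P v)
  obtain ⟨P, M, hM, hlim⟩ := exists_polynomial_seq (hf.continuousOn (s := Icc 0 1))
  have t := tendsto_integral_comp hH hX (poleCoord_mem_Icc v)
    (fun j => (P j).continuous.measurable) hM hlim
  simp only [hP] at t
  exact tendsto_nhds_unique t tendsto_const_nhds

theorem IsGreenFunction.continuousAt {G : USphere n → USphere n → ℝ} (hG : IsGreenFunction n G)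
    {p q : USphere n} (h : p ≠ q) : ContinuousAt (G p) q := by
  have hopen : IsOpen {x : USphere n × USphere n | x.1 ≠ x.2} :=
    isOpen_ne_fun continuous_fst continuous_snd
  have h1 : ContinuousAt (fun x : USphere n × USphere n => G x.1 x.2) (p, q) :=
    hG.continuousOn.continuousAt (hopen.mem_nhds h)
  exact h1.comp (f := fun q => (p, q)) (by fun_prop)

theorem continuous_mul_integrable {G L : USphere n → ℝ} (hG : Integrable G (sphereMeasure n))
    (hL : Continuous L) : Integrable (fun q => G q * L q) (sphereMeasure n) := by
  obtain ⟨C, hC⟩ := isCompact_univ.exists_bound_of_continuousOn hL.continuousOn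
  exact hG.mul_bdd hL.aestronglyMeasurable (Eventually.of_forall fun q => hC q (mem_univ q))

/-- The Green function is unique off the diagonal. -/
theorem IsGreenFunction.eq_of_ne (hn : 1 ≤ n) {G G' : USphere n → USphere n → ℝ}
    (hG : IsGreenFunction n G) (hG' : IsGreenFunction n G') {p q : USphere n} (h : p ≠ q) :
    G p q = G' p q := by
  have hH : Integrable (fun q => G p q - G' p q) (sphereMeasure n) :=
    (hG.integrable p).sub (hG'.integrable p)
  refine sub_eq_zero.1 (eq_zero_of_integral_poleCoord_eq_zero (v := q)
    (H := fun q => G p q - G' p q) hH ((hG.continuousAt h).sub (hG'.continuousAt h)) fun f hf =>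
      integral_mul_poleCoord_eq_zero hn hH ?_ (fun φ hφ => ?_) q hf)
  · rw [integral_sub (hG.integrable p) (hG'.integrable p), hG.mean_zero, hG'.mean_zero, sub_zero]
  · have hL := continuous_laplaceBeltrami hφ
    simp only [sub_mul]
    rw [integral_sub (continuous_mul_integrable (hG.integrable p) hL)
      (continuous_mul_integrable (hG'.integrable p) hL), hG.laplacian p φ hφ, hG'.laplacian p φ hφ,
      sub_self]

theorem isGreenFunction_greenFunction (hn : 1 ≤ n) : IsGreenFunction n (greenFunction n) :=
  Classical.epsilon_spec ⟨_, isGreenFunction_explicitGreen hn⟩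

end Uniqueness

/-! ### Integrals of the Green function over caps -/

section MeanValue

open Filter Topology Set

variable {n : ℕ}

theorem intervalIntegral_capPotential (hn : 1 ≤ n) {ε : ℝ} (hε : ε ∈ Ioo (0 : ℝ) 1) :
    ∫ x in (0 : ℝ)..1, betaWeight n x * capPotential n ε x
      = capInt n 1 - capInt n ε * (capBeta n 1 / capBeta n ε) := by
  have hy := one_sub_mem_Ioo hε
  have hI := (capBeta_pos hn hε.1 hε.2.le).ne'
  have hw := intervalIntegrable_betaWeight hn (a := 0) (b := ε) (by simp) ⟨hε.1.le, hε.2.le⟩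
  have hwF := intervalIntegrable_betaWeight_mul hn (a := 0) (b := ε) (by simp) ⟨hε.1.le, hε.2⟩
  have c1 : EqOn (fun x => (greenPrim n (1 - ε) + capRatio n ε * greenPrim n ε) * betaWeight n x
      - capRatio n ε * (betaWeight n x * greenPrim n x))
      (fun x => betaWeight n x * capPotential n ε x) (uIoo 0 ε) := fun x hx => by
    rw [uIoo_of_le hε.1.le] at hx
    simp only [capPotential, if_pos hx.2]
    ring
  have c2 : EqOn (fun x => betaWeight n x * greenPrim n (1 - x))
      (fun x => betaWeight n x * capPotential n ε x) (uIoo ε 1) := fun x hx => by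
    rw [uIoo_of_le hε.2.le] at hx
    simp only [capPotential, if_neg hx.1.not_gt]
  have i1 := (hw.const_mul (greenPrim n (1 - ε) + capRatio n ε * greenPrim n ε)).sub
    (hwF.const_mul (capRatio n ε))
  have i2 : IntervalIntegrable (fun x => betaWeight n x * greenPrim n (1 - x)) volume ε 1 := by
    refine (intervalIntegrable_greenPrim_flip hn).mono_set ?_
    rw [uIcc_of_le hε.2.le, uIcc_of_le (zero_le_one' ℝ)]
    exact Icc_subset_Icc_left hε.1.le
  have e2 : ∫ x in ε..1, betaWeight n x * greenPrim n (1 - x) = capInt n (1 - ε) := by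
    have h := intervalIntegral.integral_comp_sub_left
      (f := fun x => betaWeight n x * greenPrim n x) (a := ε) (b := 1) 1
    rw [capInt]
    simpa only [betaWeight_one_sub, sub_self] using h
  rw [← intervalIntegral.integral_add_adjacent_intervals (i1.congr_uIoo c1) (i2.congr_uIoo c2),
    ← intervalIntegral.integral_congr_uIoo c1, ← intervalIntegral.integral_congr_uIoo c2, e2,
    intervalIntegral.integral_sub (hw.const_mul _) (hwF.const_mul _),
    intervalIntegral.integral_const_mul, intervalIntegral.integral_const_mul, ← capBeta_eq]
  change _ * capBeta n ε - capRatio n ε * capInt n ε + _ = _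
  -- Rewriting `capInt n 1` as the invariant at ε makes the terms in `capInt n (1 - ε)` cancel.
  rw [← capRatio_add_one hn hε, ← capInvariant_eq hn hε, capInvariant]
  have : capRatio n ε * capBeta n ε = capBeta n (1 - ε) := div_mul_cancel₀ _ hI
  linear_combination greenPrim n ε * this

/-- The integral of the Green function over a cap that does not contain the pole. -/
theorem IsGreenFunction.setIntegral_poleCap (hn : 1 ≤ n) {G : USphere n → USphere n → ℝ}
    (hG : IsGreenFunction n G) {v p : USphere n} {ε : ℝ} (hε : ε ∈ Ioo (0 : ℝ) 1)
    (hp : p ∉ poleCap v ε) :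
    ∫ q in poleCap v ε, G p q ∂(sphereMeasure n) = (sphereMeasure n).real (poleCap v ε)
      * (G p v + (sphereVol n)⁻¹ * (capInt n ε / capBeta n ε)) := by
  have hV := (sphereVol_pos (n := n)).ne'
  have hI := (capBeta_pos hn hε.1 hε.2.le).ne'
  have hI1 := (capBeta_pos hn one_pos le_rfl).ne'
  have hC := (capConst_pos (n := n)).ne'
  have hpv : p ≠ v := by
    rintro rfl
    apply hp
    change poleCoord p p < ε
    rw [poleCoord_self]
    exact hε.1
  have h := zonalIdentity_capPotential (n := n) (μ := sphereMeasure n) (k := G p)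
    (l := fun _ => -(sphereVol n)⁻¹) (b := 1)
    (x₀ := poleCoord v p) hn (hG.integrable p) (integrable_const _)
    (continuous_poleCoord v).measurable (poleCoord_mem_Icc v) (poleCoord_mem_Icc v p)
    (fun P => by
      have h := hG.laplacian p _ (contMDiff_polynomial_poleCoord P v)
      simp only [laplaceBeltrami_polynomial] at h
      rw [h, integral_const_mul]
      ring) hε
  -- Mean zero removes the constant -1 from (κ+1)·1_cap - 1.
  have e1 : ∫ q, G p q * (if poleCoord v q < ε then capRatio n ε else -1) ∂(sphereMeasure n)
      = (capRatio n ε + 1) * ∫ q in poleCap v ε, G p q ∂(sphereMeasure n) := by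
    have hm := (isOpen_poleCap v ε).measurableSet
    have h3 := integral_sub (((hG.integrable p).indicator hm).const_mul (capRatio n ε + 1))
      (hG.integrable p)
    rw [hG.mean_zero, sub_zero] at h3
    rw [← integral_indicator hm, ← integral_const_mul, ← h3]
    refine integral_congr_ae (Eventually.of_forall fun q => ?_)
    by_cases hq : poleCoord v q < ε
    · simp [poleCap, hq]; ring
    · simp [poleCap, hq]
  have hp' : ¬ poleCoord v p < ε := hp
  rw [e1, integral_const_mul, integral_comp_poleCoord hn v (measurable_capPotential hn ε),
    intervalIntegral_capPotential hn hε, capRatio_add_one hn hε, capPotential, if_neg hp'] at h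
  -- As `p` lies outside the cap, the potential there is F(1-x); uniqueness lets the closed form of
  -- G(p, v) supply the same value.
  rw [hG.eq_of_ne hn (isGreenFunction_explicitGreen hn) hpv, explicitGreen, greenMean,
    poleCoord_comm p v, sphereMeasure_real_poleCap hn v ⟨hε.1.le, hε.2.le⟩]
  rw [sphereVol_eq_capConst hn] at h ⊢
  generalize ∫ q in poleCap v ε, G p q ∂(sphereMeasure n) = J at *
  field_simp at h ⊢
  linear_combination -h

/-- Since arccos is decreasing, distance below a means ⟨v, q⟩ > cos a, and (1 - cos a)/2 =
sin²(a/2). -/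
theorem geodesicBall_eq_poleCap (v : USphere n) {a : ℝ} (h0 : 0 ≤ a) (hπ : a ≤ Real.pi) :
    geodesicBall v a = poleCap v (Real.sin (a / 2) ^ 2) := by
  ext q
  change Real.arccos _ < a ↔ poleCoord v q < _
  have h := abs_le.1 (abs_real_inner_le_norm (v : Ambient n) (q : Ambient n))
  rw [v.norm_coe, q.norm_coe, one_mul] at h
  have ha : a = Real.arccos (Real.cos a) := (Real.arccos_cos h0 hπ).symm
  have e : Real.arccos (inner ℝ (v : Ambient n) (q : Ambient n)) < a
      ↔ Real.cos a < inner ℝ (v : Ambient n) (q : Ambient n) := by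
    conv_lhs => rw [ha]
    exact Real.strictAntiOn_arccos.lt_iff_gt h ⟨Real.neg_one_le_cos a, Real.cos_le_one a⟩
  rw [e, Real.sin_sq_eq_half_sub, poleCoord, mul_div_cancel₀ _ (two_ne_zero' ℝ)]
  constructor <;> intro h <;> linarith

end MeanValue

/-! ### The mean value formulas on geodesic balls -/

theorem mainTheorem4 (n : ℕ) (hn : 1 ≤ n) (p₀ p : USphere n) (a : ℝ) (ha : 0 < a)
    (ha' : a < Real.pi) :
    ballVol p₀ a = 2 ^ (n - 1) * sphereVol (n - 1)
        * incBeta (Real.sin (a / 2) ^ 2) ((n : ℝ) / 2) ((n : ℝ) / 2) ∧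
    (p ∉ geodesicBall p₀ a →
      (ballVol p₀ a)⁻¹ * ∫ q in geodesicBall p₀ a, greenFunction n p q ∂(sphereMeasure n)
        = greenFunction n p p₀ + greenConst n a) ∧
    (p ∈ geodesicBall p₀ a →
      (ballVol p₀ a)⁻¹ * ∫ q in geodesicBall p₀ a, greenFunction n p q ∂(sphereMeasure n)
        = -(incBeta (Real.cos (a / 2) ^ 2) ((n : ℝ) / 2) ((n : ℝ) / 2)
            / incBeta (Real.sin (a / 2) ^ 2) ((n : ℝ) / 2) ((n : ℝ) / 2))
          * (greenFunction n p (-p₀) + greenConst n (Real.pi - a))) := by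
  have hG := isGreenFunction_greenFunction hn
  have hs : 0 < Real.sin (a / 2) := Real.sin_pos_of_pos_of_lt_pi (by linarith) (by linarith)
  have hc : 0 < Real.cos (a / 2) := Real.cos_pos_of_mem_Ioo ⟨by linarith, by linarith⟩
  have hsc := Real.sin_sq_add_cos_sq (a / 2)
  have hε : Real.sin (a / 2) ^ 2 ∈ Set.Ioo (0 : ℝ) 1 :=
    ⟨by positivity, by linarith [pow_pos hc 2]⟩
  have hcos : Real.cos (a / 2) ^ 2 = 1 - Real.sin (a / 2) ^ 2 := by linarith
  have hflip : Real.sin ((Real.pi - a) / 2) ^ 2 = 1 - Real.sin (a / 2) ^ 2 := by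
    rw [← hcos, sub_div, Real.sin_pi_div_two_sub]
  have hK := greenConst_eq hn hε
  have hK' := greenConst_eq (a := Real.pi - a) hn (by rw [hflip]; exact one_sub_mem_Ioo hε)
  rw [hflip] at hK'
  have hvol := fun v : USphere n =>
    sphereMeasure_real_poleCap hn v (ε := Real.sin (a / 2) ^ 2) ⟨hε.1.le, hε.2.le⟩
  have hy := one_sub_mem_Ioo hε
  rw [ballVol, geodesicBall_eq_poleCap p₀ ha.le ha'.le, hcos]
  generalize Real.sin (a / 2) ^ 2 = ε at *
  have hIε := capBeta_pos hn hε.1 hε.2.le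
  have hpos : 0 < (sphereMeasure n).real (poleCap p₀ ε) := by
    rw [hvol]; exact mul_pos capConst_pos hIε
  refine ⟨hvol p₀, fun hp => ?_, fun hp => ?_⟩
  · rw [hG.setIntegral_poleCap hn hε hp, hK, inv_mul_cancel_left₀ hpos.ne']
  · have hp' : p ∉ poleCap (-p₀) (1 - ε) := fun h => by
      have h1 : poleCoord (-p₀) p < 1 - ε := h
      have h2 : poleCoord p₀ p < ε := hp
      rw [poleCoord_neg] at h1
      linarith
    have h1 := hG.setIntegral_poleCap hn hy hp'
    rw [← hK', sphereMeasure_real_poleCap hn (-p₀) ⟨hy.1.le, hy.2.le⟩] at h1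
    -- The two sets differ exactly by the boundary sphere x = ε, which is null.
    have hcompl : ((poleCap p₀ ε)ᶜ : Set (USphere n)) =ᵐ[sphereMeasure n] poleCap (-p₀) (1 - ε) := by
      filter_upwards [ae_poleCoord_ne hn p₀ ε] with q hq
      refine propext ?_
      change ¬ poleCoord p₀ q < ε ↔ poleCoord (-p₀) q < 1 - ε
      rw [poleCoord_neg, not_lt]
      constructor
      · intro h
        linarith [lt_of_le_of_ne h hq.symm]
      · intro h
        linarith
    have h2 := integral_add_compl (isOpen_poleCap p₀ ε).measurableSet (hG.integrable p)
    rw [setIntegral_congr_set hcompl, hG.mean_zero, h1] at h2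
    change _ = -(capBeta n (1 - ε) / capBeta n ε) * _
    rw [hvol, eq_neg_of_add_eq_zero_left h2]
    have := (capConst_pos (n := n)).ne'
    have := hIε.ne'
    field_simp
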